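/- Let $n\ge 1$. For an open bounded set $\Omega\subset\mathbb R^n$ and a function $\alpha:\Omega\to(0,1]$ put $\alpha^-=\inf_\Omega\alpha$ and $\alpha^+=\sup_\Omega\alpha$. Write $\alpha\in\mathcal A^{\log}(\Omega)$ if $0<\alpha^-\le\alpha^+<1$ and there is $M>0$ with $$\bigl|\ln|x-y|\bigr|\,|\alpha(x)-\alpha(y)|\le M\qquad\text{for all }x,y\in\Omega,\ x\ne y;$$ let $c_{\log}(\alpha)$ be the smallest $M\ge 0$ with this property. Let $$|u|_{0,\Omega}=\sup_{x\in\Omega}|u(x)|,\qquad [f]_{\alpha(\cdot),\Omega}=\sup_{x\ne y\in\Omega}\frac{|f(x)-f(y)|}{|x-y|^{\alpha(x)}},$$ and let $C^{\alpha(\cdot)}(\bar\Omega)$ be the set of functions $f:\Omega\to\mathbb R$ that extend continuously to $\bar\Omega$ and satisfy $|f|_{0,\Omega}+[f]_{\alpha(\cdot),\Omega}<\infty$. With $d_x=\operatorname{dist}(x,\partial\Omega)$ and $d_{x,y}=\min\{d_x,d_y\}$, set (with values in $[0,\infty]$) $$|u|^*_{2,\alpha(\cdot),\Omega}=\sum_{j=0}^{2}\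 \sup_{x\in\Omega,\ |\beta|=j}d_x^{\,j}|D^\beta u(x)|+\sup_{x\ne y\in\Omega,\ |\beta|=2}d_{x,y}^{\,2+\alpha(x)}\frac{|D^\beta u(x)-D^\beta u(y)|}{|x-y|^{\alpha(x)}},$$ $$|f|^{(2)}_{0,\alpha(\cdot),\Omega}=\sup_{x\in\Omega}d_x^{\,2}|f(x)|+\sup_{x\ne y\in\Omega}d_{x,y}^{\,2+\alpha(x)}\frac{|f(x)-f(y)|}{|x-y|^{\alpha(x)}}.$$ **Theorem.** Let $\Omega\subset\mathbb R^n$ be open and bounded and let $\alpha\in\mathcal A^{\log}(\Omega)$. Let $u:\Omega\to\mathbb R$ be twice continuously differentiable, let $f\in C^{\alpha(\cdot)}(\bar\Omega)$, and suppose that $\Delta u=f$ in $\Omega$. Then $$|u|^*_{2,\alpha(\cdot),\Omega}\le C\left(|u|_{0,\Omega}+|f|^{(2)}_{0,\alpha(\cdot),\Omega}\right),$$ where the finite constant $C=C(\operatorname{diam}(\Omega),n,\alpha^-,\alpha^+,c_{\log}(\alpha))$ depends only on the listed quantities. (If $u$ is unbounded, the right-hand side may be $+\infty$.) -/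

import Mathlib

open scoped ENNReal NNReal Laplacian

noncomputable section

namespace VarHolder

variable {n : ℕ}

/-- The supremum `α⁺` of the exponent `α` over `Ω`. -/
def expSup (Ω : Set (EuclideanSpace ℝ (Fin n))) (α : EuclideanSpace ℝ (Fin n) → ℝ) : ℝ :=
  sSup (α '' Ω)

/-- The infimum `α⁻` of the exponent `α` over `Ω`. -/
def expInf (Ω : Set (EuclideanSpace ℝ (Fin n))) (α : EuclideanSpace ℝ (Fin n) → ℝ) : ℝ :=
  sInf (α '' Ω)

/-- `M` is an admissible constant in the log-Hölder condition for `α` on `Ω`.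
(For `x = y` the inequality reads `0 ≤ M`.) -/
def LogHolderBound (Ω : Set (EuclideanSpace ℝ (Fin n))) (α : EuclideanSpace ℝ (Fin n) → ℝ)
    (M : ℝ) : Prop :=
  ∀ x ∈ Ω, ∀ y ∈ Ω, |Real.log (dist x y)| * |α x - α y| ≤ M

/-- The class `𝒜^log(Ω)`: variable exponents `α : Ω → (0, 1]` with `0 < α⁻ ≤ α⁺ < 1` which are
log-Hölder continuous in `Ω`. -/
structure IsLogExponent (Ω : Set (EuclideanSpace ℝ (Fin n)))
    (α : EuclideanSpace ℝ (Fin n) → ℝ) : Prop where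
  mem_Ioc : ∀ x ∈ Ω, α x ∈ Set.Ioc (0 : ℝ) 1
  expInf_pos : 0 < expInf Ω α
  expSup_lt_one : expSup Ω α < 1
  logHolder : ∃ M : ℝ, 0 < M ∧ LogHolderBound Ω α M

/-- The log-Hölder constant `c_log(α)`: the smallest constant in the log-Hölder condition. -/
def cLog (Ω : Set (EuclideanSpace ℝ (Fin n))) (α : EuclideanSpace ℝ (Fin n) → ℝ) : ℝ :=
  sInf {M : ℝ | 0 ≤ M ∧ LogHolderBound Ω α M}

/-- The partial derivative `D_{σ 0} ⋯ D_{σ (k-1)} u (x)` of order `k`. For `u` of class `C^k` near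
`x`, the values for `σ : Fin k → Fin n` are exactly the `D^β u (x)` with `|β| = k`. -/
def partialD {k : ℕ} (σ : Fin k → Fin n) (u : EuclideanSpace ℝ (Fin n) → ℝ)
    (x : EuclideanSpace ℝ (Fin n)) : ℝ :=
  iteratedFDeriv ℝ k u x (fun i => EuclideanSpace.single (σ i) (1 : ℝ))

/-- The distance `d_x` of `x` to the boundary of `Ω`. -/
def bdist (Ω : Set (EuclideanSpace ℝ (Fin n))) (x : EuclideanSpace ℝ (Fin n)) : ℝ :=
  Metric.infDist x (frontier Ω)

/-- `d_{x,y} = min (d_x, d_y)`. -/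
def bdist₂ (Ω : Set (EuclideanSpace ℝ (Fin n))) (x y : EuclideanSpace ℝ (Fin n)) : ℝ :=
  min (bdist Ω x) (bdist Ω y)

/-! All (semi)norms below take values in `[0, ∞]`. -/

/-- `|u|_{0,Ω} = sup_Ω |u|`. -/
def supNorm (Ω : Set (EuclideanSpace ℝ (Fin n))) (u : EuclideanSpace ℝ (Fin n) → ℝ) : ℝ≥0∞ :=
  ⨆ x ∈ Ω, ENNReal.ofReal |u x|

/-- The Hölder seminorm `[f]_{α(·),Ω}` of variable exponent. -/
def holderSeminorm (Ω : Set (EuclideanSpace ℝ (Fin n))) (α : EuclideanSpace ℝ (Fin n) → ℝ)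
    (f : EuclideanSpace ℝ (Fin n) → ℝ) : ℝ≥0∞ :=
  ⨆ x ∈ Ω, ⨆ y ∈ Ω, ⨆ _ : x ≠ y, ENNReal.ofReal (|f x - f y| / dist x y ^ α x)

/-- `f ∈ C^{α(·)}(Ω̄)`: `f` is bounded on `Ω`, extends continuously from `Ω` to the closure of `Ω`,
and has finite Hölder seminorm on `Ω`. -/
structure MemHolderClosure (Ω : Set (EuclideanSpace ℝ (Fin n)))
    (α : EuclideanSpace ℝ (Fin n) → ℝ) (f : EuclideanSpace ℝ (Fin n) → ℝ) : Prop where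
  extends_continuously :
    ∃ g : EuclideanSpace ℝ (Fin n) → ℝ, ContinuousOn g (closure Ω) ∧ Set.EqOn g f Ω
  supNorm_lt_top : supNorm Ω f < ∞
  holderSeminorm_lt_top : holderSeminorm Ω α f < ∞

/-- `[u]*_{k,Ω} = sup d_x^k |D^β u(x)|`, over `x ∈ Ω` and `|β| = k`. -/
def starSeminorm (k : ℕ) (Ω : Set (EuclideanSpace ℝ (Fin n)))
    (u : EuclideanSpace ℝ (Fin n) → ℝ) : ℝ≥0∞ :=
  ⨆ x ∈ Ω, ⨆ σ : Fin k → Fin n, ENNReal.ofReal (bdist Ω x ^ k * |partialD σ u x|)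

/-- `[u]*_{k,α(·),Ω} = sup d_{x,y}^{k+α(x)} |D^β u(x) - D^β u(y)| / |x-y|^{α(x)}`, over
`x ≠ y` in `Ω` and `|β| = k`. -/
def starHolderSeminorm (k : ℕ) (Ω : Set (EuclideanSpace ℝ (Fin n)))
    (α : EuclideanSpace ℝ (Fin n) → ℝ) (u : EuclideanSpace ℝ (Fin n) → ℝ) : ℝ≥0∞ :=
  ⨆ x ∈ Ω, ⨆ y ∈ Ω, ⨆ _ : x ≠ y, ⨆ σ : Fin k → Fin n,
    ENNReal.ofReal
      (bdist₂ Ω x y ^ ((k : ℝ) + α x) * (|partialD σ u x - partialD σ u y| / dist x y ^ α x))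

/-- `|u|*_{k,α(·),Ω} = ∑_{j ≤ k} [u]*_{j,Ω} + [u]*_{k,α(·),Ω}`. -/
def starHolderNorm (k : ℕ) (Ω : Set (EuclideanSpace ℝ (Fin n)))
    (α : EuclideanSpace ℝ (Fin n) → ℝ) (u : EuclideanSpace ℝ (Fin n) → ℝ) : ℝ≥0∞ :=
  (∑ j ∈ Finset.range (k + 1), starSeminorm j Ω u) + starHolderSeminorm k Ω α u

/-- `[f]^{(s)}_{k,Ω} = sup d_x^{k+s} |D^β f(x)|`, over `x ∈ Ω` and `|β| = k`. -/
def weightedSeminorm (s : ℝ) (k : ℕ) (Ω : Set (EuclideanSpace ℝ (Fin n)))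
    (f : EuclideanSpace ℝ (Fin n) → ℝ) : ℝ≥0∞ :=
  ⨆ x ∈ Ω, ⨆ σ : Fin k → Fin n, ENNReal.ofReal (bdist Ω x ^ ((k : ℝ) + s) * |partialD σ f x|)

/-- `[f]^{(s)}_{k,α(·),Ω} = sup d_{x,y}^{k+α(x)+s} |D^β f(x) - D^β f(y)| / |x-y|^{α(x)}`, over
`x ≠ y` in `Ω` and `|β| = k`. -/
def weightedHolderSeminorm (s : ℝ) (k : ℕ) (Ω : Set (EuclideanSpace ℝ (Fin n)))
    (α : EuclideanSpace ℝ (Fin n) → ℝ) (f : EuclideanSpace ℝ (Fin n) → ℝ) : ℝ≥0∞ :=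
  ⨆ x ∈ Ω, ⨆ y ∈ Ω, ⨆ _ : x ≠ y, ⨆ σ : Fin k → Fin n,
    ENNReal.ofReal
      (bdist₂ Ω x y ^ ((k : ℝ) + α x + s) *
        (|partialD σ f x - partialD σ f y| / dist x y ^ α x))

/-- `|f|^{(s)}_{k,α(·),Ω} = ∑_{j ≤ k} [f]^{(s)}_{j,Ω} + [f]^{(s)}_{k,α(·),Ω}`. -/
def weightedHolderNorm (s : ℝ) (k : ℕ) (Ω : Set (EuclideanSpace ℝ (Fin n)))
    (α : EuclideanSpace ℝ (Fin n) → ℝ) (f : EuclideanSpace ℝ (Fin n) → ℝ) : ℝ≥0∞ :=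
  (∑ j ∈ Finset.range (k + 1), weightedSeminorm s j Ω f) + weightedHolderSeminorm s k Ω α f

end VarHolder

end

/-!
The estimate is proved with averages over radial kernels at all scales instead of the Newtonian
potential. Let `ψ` (`radialBump`) be smooth, radial and supported in the unit ball, and let `φ`
(`radialMass`) be the radial function with `∇ψ = -φ(z) z`; put `c = ∫ φ > 0`. For `u` of class `C²`
the averages

  `g_x(t) = t⁻² ∫ u(x + t z) ∂ᵢ∂ⱼφ(z) dz = ∫ ∂ᵢ∂ⱼu(x + t z) φ(z) dz`   (`hessAvg`)

tend to `c ∂ᵢ∂ⱼu(x)` as `t → 0` (`tendsto_hessAvg`), and integration by parts gives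
(`hasDerivAt_hessAvg`)

  `g_x'(t) = t⁻¹ ∫ Δu(x + t z) ∂ᵢ∂ⱼψ(z) dz`.

Since `∂ᵢ∂ⱼψ` has mean zero, `Δu(x + t z)` may be replaced by `Δu(x + t z) - Δu(x)`, so that
`|g_x'(t)|` is at most a multiple of `t^(α(x) - 1)`, where the exponent `α(x)` is fixed.
Integration over `(0, R)` with `R` comparable to `d_x` bounds `∂ᵢ∂ⱼu(x)`
(`abs_dirD_dirD_le`). For two points at distance `δ ≤ R`, the scales below `δ` contribute
`δ^α(x)` at `x` and `δ^α(y)` at `y`. At the scales `t` above `δ`, the difference of the two kernels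
gains a factor `δ / t`, and `∫ t^(α(x) - 2) δ dt` over `t > δ` is a multiple of `δ^α(x)` because
`α(x) < 1` (`abs_dirD_dirD_sub_le`).

The variable exponent matters only through the term `δ^α(y)`: the log-Hölder condition bounds
`(δ/d)^α(y)` by a constant times `(δ/d)^α(x)` (`LogHolderBound.rpow_le`). Points far apart relative
to `d_{x,y}` are covered by the bound for the second derivatives, and the first derivatives by
interpolation (`PoissonBounds.bdist_mul_abs_dirD_le`).
-/

open MeasureTheory Filter Topology Metric
open scoped ContDiff

namespace VarHolder

/-! ### Directional derivatives and the two radial kernels -/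


section Kernels

variable {E : Type*} [NormedAddCommGroup E] [InnerProductSpace ℝ E]

/-- The directional derivative of `f` in the direction `a`, as a function of the base point. -/
noncomputable def dirD (a : E) (f : E → ℝ) (z : E) : ℝ :=
  fderiv ℝ f z a

/-- A smooth function supported in the closed unit ball. -/
structure IsKernel (K : E → ℝ) : Prop where
  smooth : ContDiff ℝ ∞ K
  tsupport_subset : tsupport K ⊆ closedBall 0 1

theorem contDiff_dirD {m k : ℕ∞ω} {f : E → ℝ} (hf : ContDiff ℝ k f) (h : m + 1 ≤ k) (a : E) :
    ContDiff ℝ m (dirD a f) :=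
  (hf.fderiv_right h).clm_apply contDiff_const

theorem IsKernel.isKernel_dirD {K : E → ℝ} (hK : IsKernel K) (a : E) : IsKernel (dirD a K) where
  smooth := contDiff_dirD hK.smooth le_rfl a
  tsupport_subset := (tsupport_fderiv_apply_subset ℝ a).trans hK.tsupport_subset

theorem IsKernel.hasCompactSupport [FiniteDimensional ℝ E] {K : E → ℝ} (hK : IsKernel K) :
    HasCompactSupport K :=
  HasCompactSupport.of_support_subset_isCompact (isCompact_closedBall 0 1)
    ((subset_tsupport K).trans hK.tsupport_subset)

theorem IsKernel.eq_zero {K : E → ℝ} (hK : IsKernel K) {z : E} (hz : 1 < ‖z‖) : K z = 0 :=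
  image_eq_zero_of_notMem_tsupport fun h => by
    have := hK.tsupport_subset h
    rw [mem_closedBall_zero_iff] at this
    linarith

theorem IsKernel.contDiff_two {K : E → ℝ} (hK : IsKernel K) : ContDiff ℝ 2 K :=
  contDiff_infty.1 hK.smooth 2

theorem IsKernel.sub_comp_eq_zero {K : E → ℝ} (hK : IsKernel K) {h z : E} (hh : ‖h‖ ≤ 1)
    (hz : 2 < ‖z‖) : K z - K (z - h) = 0 := by
  have := norm_sub_norm_le z h
  rw [hK.eq_zero (by linarith), hK.eq_zero (by linarith), sub_zero]

theorem dirD_comm {f : E → ℝ} (hf : ContDiff ℝ 2 f) (a b : E) :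
    dirD a (dirD b f) = dirD b (dirD a f) := by
  funext z
  have hd : DifferentiableAt ℝ (fderiv ℝ f) z :=
    (hf.fderiv_right (m := 1) (by norm_num)).differentiable one_ne_zero z
  have hs : IsSymmSndFDerivAt ℝ f z := hf.contDiffAt.isSymmSndFDerivAt (by simp)
  have e (v w : E) : dirD v (dirD w f) z = fderiv ℝ (fderiv ℝ f) z v w := by
    change fderiv ℝ (fun y => fderiv ℝ f y w) z v = _
    rw [fderiv_clm_apply hd (differentiableAt_const w)]
    simp
  rw [e, e, hs.eq]

theorem laplacian_eq_sum_dirD [FiniteDimensional ℝ E] {ι : Type*} [Fintype ι]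
    (e : OrthonormalBasis ι ℝ E) {u : E → ℝ} (hu : ContDiff ℝ 2 u) (x : E) :
    (Δ u) x = ∑ k, dirD (e k) (dirD (e k) u) x := by
  have hd : DifferentiableAt ℝ (fderiv ℝ u) x :=
    (hu.fderiv_right (m := 1) (by norm_num)).differentiable one_ne_zero x
  rw [InnerProductSpace.laplacian_eq_iteratedFDeriv_orthonormalBasis u e]
  refine Finset.sum_congr rfl fun k _ => ?_
  change _ = fderiv ℝ (fun y => fderiv ℝ u y (e k)) x (e k)
  rw [iteratedFDeriv_two_apply, fderiv_clm_apply hd (differentiableAt_const _)]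
  simp

theorem continuous_laplacian [FiniteDimensional ℝ E] {u : E → ℝ} (hu : ContDiff ℝ 2 u) :
    Continuous (Δ u) := by
  rw [funext (laplacian_eq_sum_dirD (stdOrthonormalBasis ℝ E) hu)]
  refine continuous_finsetSum _ fun k _ => ?_
  exact (contDiff_dirD (m := 0) (contDiff_dirD (m := 1) hu (by norm_num) _)
    (by norm_num) _).continuous

/-- The smooth radial function `exp (-1 / (1 - ‖z‖²))` on the unit ball, extended by zero. -/
noncomputable def radialBump (z : E) : ℝ :=
  expNegInvGlue (1 - ‖z‖ ^ 2)

/-- The smooth radial function `φ` with `∇ψ = -φ(z) z`, where `ψ` is `radialBump`. -/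
noncomputable def radialMass (z : E) : ℝ :=
  2 * deriv expNegInvGlue (1 - ‖z‖ ^ 2)

theorem contDiff_radialBump : ContDiff ℝ ∞ (radialBump : E → ℝ) :=
  expNegInvGlue.contDiff.comp (contDiff_const.sub (contDiff_norm_sq ℝ))

theorem contDiff_radialMass : ContDiff ℝ ∞ (radialMass : E → ℝ) := by
  have h : ContDiff ℝ ∞ (deriv expNegInvGlue) :=
    (contDiff_infty_iff_deriv.1 expNegInvGlue.contDiff).2
  exact contDiff_const.mul (h.comp (contDiff_const.sub (contDiff_norm_sq ℝ)))

theorem isKernel_radialBump : IsKernel (radialBump : E → ℝ) where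
  smooth := contDiff_radialBump
  tsupport_subset := by
    refine closure_minimal (fun z hz => ?_) isClosed_closedBall
    rw [mem_closedBall_zero_iff]
    by_contra! h
    exact hz (expNegInvGlue.zero_of_nonpos (by nlinarith))

theorem isKernel_radialMass : IsKernel (radialMass : E → ℝ) where
  smooth := contDiff_radialMass
  tsupport_subset := by
    refine closure_minimal (fun z hz => ?_) isClosed_closedBall
    rw [mem_closedBall_zero_iff]
    by_contra! h
    refine hz ?_
    have h0 : expNegInvGlue =ᶠ[𝓝 (1 - ‖z‖ ^ 2)] fun _ => 0 := by
      filter_upwards [gt_mem_nhds (show 1 - ‖z‖ ^ 2 < 0 by nlinarith)] with s hs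
      exact expNegInvGlue.zero_of_nonpos hs.le
    simp [radialMass, h0.deriv_eq]

theorem radialMass_nonneg {F : Type*} [NormedAddCommGroup F] (z : F) : 0 ≤ radialMass z :=
  mul_nonneg zero_le_two (expNegInvGlue.monotone.deriv_nonneg)

theorem dirD_radialBump (a : E) :
    dirD a (radialBump : E → ℝ) = fun z => -(inner ℝ z a * radialMass z) := by
  funext z
  have h1 : HasFDerivAt (fun z : E => 1 - ‖z‖ ^ 2) (-(2 • (innerSL ℝ) z)) z := by
    simpa using (hasStrictFDerivAt_norm_sq z).hasFDerivAt.const_sub 1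
  have h2 : HasDerivAt expNegInvGlue (deriv expNegInvGlue (1 - ‖z‖ ^ 2)) (1 - ‖z‖ ^ 2) :=
    ((expNegInvGlue.contDiff (n := 1)).differentiable (by norm_num) _).hasDerivAt
  have h3 := h2.comp_hasFDerivAt z h1
  rw [dirD, show (radialBump : E → ℝ) = expNegInvGlue ∘ fun z => 1 - ‖z‖ ^ 2 from rfl, h3.fderiv]
  simp [radialMass]
  ring

/-- The second derivatives of `∇ψ = -φ(z) z`: this is `∂ᵢ∂ⱼ∂ₖψ = -∂ᵢ∂ⱼ(zₖ φ)`, written so that the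
term `zₖ ∂ᵢ∂ⱼφ` can be eliminated. -/
theorem dirD_dirD_dirD_radialBump (a b c : E) (z : E) :
    dirD c (dirD a (dirD b (radialBump : E → ℝ))) z =
      -(inner ℝ z c * dirD a (dirD b radialMass) z + inner ℝ a c * dirD b radialMass z +
        inner ℝ b c * dirD a radialMass z) := by
  have hψ : ContDiff ℝ ∞ (radialBump : E → ℝ) := contDiff_radialBump
  have hφ : ContDiff ℝ ∞ (radialMass : E → ℝ) := contDiff_radialMass
  have hd {f : E → ℝ} (hf : ContDiff ℝ ∞ f) (z : E) : DifferentiableAt ℝ f z :=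
    hf.differentiable (by simp) z
  have hi : ContDiff ℝ ∞ fun z : E => inner ℝ z c := contDiff_id.inner ℝ contDiff_const
  have hprod (v : E) {f : E → ℝ} (hf : ContDiff ℝ ∞ f) (w : E) :
      dirD v (fun z => inner ℝ z c * f z) w = inner ℝ w c * dirD v f w + inner ℝ v c * f w := by
    have hic : fderiv ℝ (fun z : E => inner ℝ z c) w v = inner ℝ v c := by
      rw [fderiv_inner_apply ℝ differentiableAt_fun_id (differentiableAt_const c)]
      simp
    rw [dirD, fderiv_fun_mul (hd hi w) (hd hf w)]
    simp [hic, dirD]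
    ring
  rw [dirD_comm (isKernel_radialBump.isKernel_dirD b).contDiff_two,
    dirD_comm isKernel_radialBump.contDiff_two c b,
    dirD_radialBump]
  have e1 : dirD b (fun z : E => -(inner ℝ z c * radialMass z)) =
      fun w => -(inner ℝ w c * dirD b radialMass w + inner ℝ b c * radialMass w) := by
    funext w
    rw [← hprod b hφ w]
    simp [dirD]
  rw [e1]
  have h1 : ContDiff ℝ ∞ fun w : E => inner ℝ w c * dirD b radialMass w :=
    hi.mul (contDiff_dirD hφ le_rfl b)
  have h2 : dirD a (fun w : E => -(inner ℝ w c * dirD b radialMass w + inner ℝ b c * radialMass w)) z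
      = -(dirD a (fun w : E => inner ℝ w c * dirD b radialMass w) z +
        inner ℝ b c * dirD a radialMass z) := by
    rw [dirD, fderiv_fun_neg, fderiv_fun_add (hd h1 z) ((hd hφ z).const_mul _),
      fderiv_const_mul (hd hφ z)]
    simp [dirD]
  rw [h2, hprod a (contDiff_dirD hφ le_rfl b)]

end Kernels

/-! ### Averages against a kernel and their dependence on the scale -/


section Averages

variable {E : Type*} [NormedAddCommGroup E] [InnerProductSpace ℝ E] [FiniteDimensional ℝ E]
  [MeasurableSpace E] [BorelSpace E]

theorem IsKernel.integrable_mul {K w : E → ℝ} (hK : IsKernel K) (hw : Continuous w) (x : E)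
    (t : ℝ) : Integrable fun z => w (x + t • z) * K z :=
  Continuous.integrable_of_hasCompactSupport
    ((hw.comp (by fun_prop)).mul hK.smooth.continuous) hK.hasCompactSupport.mul_left

theorem IsKernel.integrable {K : E → ℝ} (hK : IsKernel K) : Integrable K :=
  hK.smooth.continuous.integrable_of_hasCompactSupport hK.hasCompactSupport

/-- Integration by parts in the integral of `w (x + t z) K z` over `z`. -/
theorem IsKernel.integral_dirD_mul {K w : E → ℝ} (hK : IsKernel K) (hw : ContDiff ℝ 1 w)
    (a x : E) (t : ℝ) :
    t * ∫ z, dirD a w (x + t • z) * K z = -∫ z, w (x + t • z) * dirD a K z := by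
  have hg (z : E) : HasFDerivAt (fun z : E => w (x + t • z))
      ((fderiv ℝ w (x + t • z)).comp (t • ContinuousLinearMap.id ℝ E)) z :=
    (hw.differentiable one_ne_zero _).hasFDerivAt.comp z
      (((hasFDerivAt_id z).const_smul t).const_add x)
  have hf (z : E) : fderiv ℝ (fun z : E => w (x + t • z)) z a = t * dirD a w (x + t • z) := by
    rw [(hg z).fderiv]
    simp [dirD]
  have hwa : Continuous (dirD a w) := (contDiff_dirD (m := 0) hw (by norm_num) a).continuous
  have h := integral_mul_fderiv_eq_neg_fderiv_mul_of_integrable (μ := volume)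
    (f := fun z : E => w (x + t • z)) (g := K) (v := a)
    (by
      simp_rw [hf, mul_assoc]
      exact (hK.integrable_mul hwa x t).const_mul t)
    ((hK.isKernel_dirD a).integrable_mul hw.continuous x t)
    (hK.integrable_mul hw.continuous x t)
    (fun z _ => (hg z).differentiableAt)
    (fun z _ => hK.smooth.differentiable (by simp) z)
  simp_rw [hf, mul_assoc, integral_const_mul] at h
  rw [← neg_eq_iff_eq_neg.2 h]
  simp [dirD]

theorem IsKernel.integral_dirD {K : E → ℝ} (hK : IsKernel K) (a : E) : ∫ z, dirD a K z = 0 := by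
  have h := hK.integral_dirD_mul (w := fun _ => 1) contDiff_const a 0 1
  simp [dirD] at h
  simpa [dirD] using h

theorem IsKernel.continuous_integral_mul {K w : E → ℝ} (hK : IsKernel K) (hw : Continuous w)
    (x : E) : Continuous fun t : ℝ => ∫ z, w (x + t • z) * K z := by
  rw [← continuousOn_univ]
  refine continuousOn_integral_of_compact_support (isCompact_closedBall (0 : E) 1) ?_ ?_
  · have := hK.smooth.continuous
    refine Continuous.continuousOn ?_
    simp only [Function.uncurry_def]
    fun_prop
  · intro t z _ hz
    rw [mem_closedBall_zero_iff, not_le] at hz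
    simp [hK.eq_zero hz]

theorem IsKernel.hasDerivAt_integral_mul {K w : E → ℝ} (hK : IsKernel K) (hw : ContDiff ℝ 1 w)
    (x : E) (t : ℝ) :
    HasDerivAt (fun t : ℝ => ∫ z, w (x + t • z) * K z)
      (∫ z, fderiv ℝ w (x + t • z) z * K z) t := by
  have hKc := hK.smooth.continuous
  have hwc := hw.continuous_fderiv one_ne_zero
  have hF : Continuous fun p : ℝ × E => fderiv ℝ w (x + p.1 • p.2) p.2 * K p.2 :=
    ((hwc.comp (by fun_prop)).clm_apply continuous_snd).mul (hKc.comp continuous_snd)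
  obtain ⟨C, hC⟩ := ((isCompact_closedBall t 1).prod
    (isCompact_closedBall (0 : E) 1)).exists_bound_of_continuousOn hF.continuousOn
  refine (hasDerivAt_integral_of_dominated_loc_of_deriv_le
    (F := fun (t : ℝ) (z : E) => w (x + t • z) * K z)
    (F' := fun (t : ℝ) (z : E) => fderiv ℝ w (x + t • z) z * K z)
    (bound := (closedBall (0 : E) 1).indicator fun _ => C)
    (closedBall_mem_nhds t one_pos) (Eventually.of_forall fun s => ?_)
    (hK.integrable_mul hw.continuous x t) ?_ (Eventually.of_forall fun z s hs => ?_) ?_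
    (Eventually.of_forall fun z s _ => ?_)).2
  · exact (hK.integrable_mul hw.continuous x s).aestronglyMeasurable
  · exact (hF.comp (Continuous.prodMk_right t)).aestronglyMeasurable
  · by_cases hz : z ∈ closedBall (0 : E) 1
    · rw [Set.indicator_of_mem hz]
      exact hC (s, z) ⟨hs, hz⟩
    · rw [Set.indicator_of_notMem hz]
      rw [mem_closedBall_zero_iff, not_le] at hz
      simp [hK.eq_zero hz]
  · exact (integrable_indicator_iff measurableSet_closedBall).2
      (integrableOn_const (isCompact_closedBall (0 : E) 1).measure_ne_top)
  · have h1 : HasDerivAt (fun s : ℝ => x + s • z) z s := by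
      simpa using ((hasDerivAt_id s).smul_const z).const_add x
    exact ((hw.differentiable one_ne_zero _).hasFDerivAt.comp_hasDerivAt s h1).mul_const _

/-- With `φ = radialMass` and `ψ = radialBump`, the rescaled averages of `u` against `∂ₐ∂ₐ'φ`
have a derivative in the scale that involves `u` only through `Δu`. -/
theorem hasDerivAt_integral_mul_dirD_radialMass {u : E → ℝ} (hu : ContDiff ℝ 2 u) (a a' x : E)
    {t : ℝ} (ht : t ≠ 0) :
    HasDerivAt (fun t : ℝ => ∫ z, u (x + t • z) * dirD a (dirD a' radialMass) z)
      (t * (∫ z, (Δ u) (x + t • z) * dirD a (dirD a' radialBump) z) +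
        2 / t * ∫ z, u (x + t • z) * dirD a (dirD a' radialMass) z) t := by
  have hφ : IsKernel (radialMass : E → ℝ) := isKernel_radialMass
  have hL : IsKernel (dirD a (dirD a' (radialBump : E → ℝ))) :=
    (isKernel_radialBump.isKernel_dirD a').isKernel_dirD a
  have hu1 : ContDiff ℝ 1 u := hu.of_le (by norm_num)
  have hdu (v : E) : ContDiff ℝ 1 (dirD v u) := contDiff_dirD hu (by norm_num) v
  convert ((hφ.isKernel_dirD a').isKernel_dirD a).hasDerivAt_integral_mul hu1 x t using 1
  let e := stdOrthonormalBasis ℝ E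
  have hcoord (y v : E) : fderiv ℝ u y v = ∑ k, inner ℝ v (e k) * dirD (e k) u y := by
    conv_lhs => rw [← e.sum_repr' v]
    simp [dirD, real_inner_comm]
  have hpt (z : E) : fderiv ℝ u (x + t • z) z * dirD a (dirD a' radialMass) z =
      (-∑ k, dirD (e k) u (x + t • z) * dirD (e k) (dirD a (dirD a' radialBump)) z) -
        dirD a u (x + t • z) * dirD a' radialMass z -
        dirD a' u (x + t • z) * dirD a radialMass z := by
    have h1 : dirD a u (x + t • z) = _ := hcoord (x + t • z) a
    have h2 : dirD a' u (x + t • z) = _ := hcoord (x + t • z) a'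
    rw [hcoord, h1, h2]
    simp_rw [dirD_dirD_dirD_radialBump, Finset.sum_mul]
    rw [← Finset.sum_neg_distrib, ← Finset.sum_sub_distrib, ← Finset.sum_sub_distrib]
    refine Finset.sum_congr rfl fun k _ => ?_
    ring
  have hik (k) := (hL.isKernel_dirD (e k)).integrable_mul (hdu (e k)).continuous x t
  have hi1 := (hφ.isKernel_dirD a').integrable_mul (hdu a).continuous x t
  have hi2 := (hφ.isKernel_dirD a).integrable_mul (hdu a').continuous x t
  have hb1 := (hφ.isKernel_dirD a').integral_dirD_mul hu1 a x t
  have hb2 := (hφ.isKernel_dirD a).integral_dirD_mul hu1 a' x t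
  rw [dirD_comm hφ.contDiff_two a' a] at hb2
  have hb3 : ∑ k, ∫ z, dirD (e k) u (x + t • z) * dirD (e k) (dirD a (dirD a' radialBump)) z =
      -(t * ∫ z, (Δ u) (x + t • z) * dirD a (dirD a' radialBump) z) := by
    simp_rw [laplacian_eq_sum_dirD e hu, Finset.sum_mul]
    rw [integral_finsetSum _ fun k _ => hL.integrable_mul
      (contDiff_dirD (m := 0) (hdu (e k)) (by norm_num) (e k)).continuous x t,
      Finset.mul_sum, ← Finset.sum_neg_distrib]
    refine Finset.sum_congr rfl fun k _ => ?_
    rw [hL.integral_dirD_mul (hdu (e k)) (e k) x t, neg_neg]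
  simp_rw [hpt]
  have hs : Integrable fun z =>
      -∑ k, dirD (e k) u (x + t • z) * dirD (e k) (dirD a (dirD a' radialBump)) z :=
    (integrable_finsetSum Finset.univ fun k _ => hik k).neg
  have hs1 : Integrable fun z =>
      (-∑ k, dirD (e k) u (x + t • z) * dirD (e k) (dirD a (dirD a' radialBump)) z) -
        dirD a u (x + t • z) * dirD a' radialMass z := hs.sub hi1
  rw [integral_sub hs1 hi2, integral_sub hs hi1, integral_neg,
    integral_finsetSum _ fun k _ => hik k, hb3, neg_neg]
  set G := ∫ z, u (x + t • z) * dirD a (dirD a' radialMass) z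
  have h1 : ∫ z, dirD a u (x + t • z) * dirD a' radialMass z = -(G / t) := by
    field_simp
    linarith
  have h2 : ∫ z, dirD a' u (x + t • z) * dirD a radialMass z = -(G / t) := by
    field_simp
    linarith
  rw [h1, h2]
  ring

/-- The average at scale `t` around `x` of `u` against the second derivative `∂ₐ∂ₐ'φ` of
`φ = radialMass`. By integration by parts it is the average of `∂ₐ∂ₐ'u` against `φ`. -/
noncomputable def hessAvg (a a' : E) (u : E → ℝ) (x : E) (t : ℝ) : ℝ :=
  (t ^ 2)⁻¹ * ∫ z, u (x + t • z) * dirD a (dirD a' radialMass) z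

/-- The total mass of `radialMass`. -/
noncomputable def massConst (E : Type*) [NormedAddCommGroup E] [InnerProductSpace ℝ E]
    [FiniteDimensional ℝ E] [MeasurableSpace E] [BorelSpace E] : ℝ :=
  ∫ z : E, radialMass z

theorem massConst_pos [Nontrivial E] : 0 < massConst E := by
  obtain ⟨z, hz⟩ : ∃ z : E, radialMass z ≠ 0 := by
    by_contra! h
    have hd (z : E) : fderiv ℝ (radialBump : E → ℝ) z = 0 := by
      ext a
      have := congrFun (dirD_radialBump a) z
      simpa [dirD, h] using this
    obtain ⟨v, hv⟩ := exists_norm_eq E zero_le_one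
    have h0 := is_const_of_fderiv_eq_zero (contDiff_radialBump.differentiable (by simp)) hd 0 v
    have h1 : (0 : ℝ) < expNegInvGlue 1 := expNegInvGlue.pos_of_pos one_pos
    simp [radialBump, hv] at h0
    linarith
  exact contDiff_radialMass.continuous.integral_pos_of_hasCompactSupport_nonneg_nonzero
    isKernel_radialMass.hasCompactSupport radialMass_nonneg hz

theorem hasDerivAt_hessAvg {u : E → ℝ} (hu : ContDiff ℝ 2 u) (a a' x : E) {t : ℝ} (ht : t ≠ 0) :
    HasDerivAt (hessAvg a a' u x)
      (t⁻¹ * ∫ z, (Δ u) (x + t • z) * dirD a (dirD a' radialBump) z) t := by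
  have h := ((hasDerivAt_pow 2 t).inv (pow_ne_zero 2 ht)).mul
    (hasDerivAt_integral_mul_dirD_radialMass hu a a' x ht)
  refine h.congr_deriv ?_
  simp only [Pi.inv_apply]
  field_simp
  ring

theorem tendsto_hessAvg {u : E → ℝ} (hu : ContDiff ℝ 2 u) (a a' x : E) :
    Tendsto (hessAvg a a' u x) (𝓝[>] 0) (𝓝 (dirD a (dirD a' u) x * massConst E)) := by
  have hφ : IsKernel (radialMass : E → ℝ) := isKernel_radialMass
  have hu1 : ContDiff ℝ 1 u := hu.of_le (by norm_num)
  have hdu : ContDiff ℝ 1 (dirD a' u) := contDiff_dirD hu (by norm_num) a'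
  have hddu : Continuous (dirD a (dirD a' u)) :=
    (contDiff_dirD (m := 0) hdu (by norm_num) a).continuous
  have h := ((hφ.continuous_integral_mul hddu x).tendsto 0).mono_left
    (nhdsWithin_le_nhds (s := Set.Ioi 0))
  simp only [zero_smul, add_zero, integral_const_mul] at h
  refine h.congr' ?_
  filter_upwards [self_mem_nhdsWithin] with t ht
  have ht' : t ≠ 0 := ne_of_gt ht
  have h1 := hφ.integral_dirD_mul hdu a x t
  have h2 := (hφ.isKernel_dirD a).integral_dirD_mul hu1 a' x t
  rw [dirD_comm hφ.contDiff_two a' a] at h2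
  rw [hessAvg]
  field_simp
  linear_combination t * h1 - h2

end Averages

/-! ### Estimates for functions on the whole space -/


theorem abs_sub_le_sub_of_abs_deriv_le {g g' G G' : ℝ → ℝ} {s b : ℝ} (hsb : s ≤ b)
    (hg : ∀ t ∈ Set.Icc s b, HasDerivAt g (g' t) t) (hG : ∀ t ∈ Set.Icc s b, HasDerivAt G (G' t) t)
    (h : ∀ t ∈ Set.Icc s b, |g' t| ≤ G' t) : |g b - g s| ≤ G b - G s := by
  refine image_norm_le_of_norm_deriv_right_le_deriv_boundary' (f := fun t => g t - g s) (f' := g')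
    (B := fun t => G t - G s) (B' := G') (a := s) (b := b)
    (fun t ht => ((hg t ht).sub_const _).continuousAt.continuousWithinAt)
    (fun t ht => ((hg t ⟨ht.1, ht.2.le⟩).sub_const _).hasDerivWithinAt) (by simp)
    (fun t ht => ((hG t ht).sub_const _).continuousAt.continuousWithinAt)
    (fun t ht => ((hG t ⟨ht.1, ht.2.le⟩).sub_const _).hasDerivWithinAt)
    (fun t ht => h t ⟨ht.1, ht.2.le⟩) ⟨hsb, le_rfl⟩

theorem abs_sub_le_of_abs_deriv_le_rpow {g g' : ℝ → ℝ} {b B p ℓ : ℝ} (hb : 0 < b) (hp : 0 < p)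
    (hB : 0 ≤ B) (hg : ∀ t ∈ Set.Ioc 0 b, HasDerivAt g (g' t) t)
    (h : ∀ t ∈ Set.Ioc 0 b, |g' t| ≤ B * t ^ (p - 1)) (hl : Tendsto g (𝓝[>] 0) (𝓝 ℓ)) :
    |g b - ℓ| ≤ B * b ^ p / p := by
  have hlim : Tendsto (fun s => |g b - g s|) (𝓝[>] 0) (𝓝 |g b - ℓ|) :=
    (tendsto_const_nhds.sub hl).abs
  refine le_of_tendsto hlim ?_
  filter_upwards [Ioc_mem_nhdsGT hb] with s hs
  have hsub {t : ℝ} (ht : t ∈ Set.Icc s b) : t ∈ Set.Ioc 0 b := ⟨hs.1.trans_le ht.1, ht.2⟩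
  have := abs_sub_le_sub_of_abs_deriv_le (G := fun t => B * t ^ p / p)
    (G' := fun t => B * t ^ (p - 1)) hs.2 (fun t ht => hg t (hsub ht)) (fun t ht => ?_)
    (fun t ht => h t (hsub ht))
  · refine this.trans (sub_le_self _ ?_)
    have := hs.1
    positivity
  · refine (((Real.hasDerivAt_rpow_const (p := p) (Or.inl (hsub ht).1.ne')).const_mul
      B).div_const p).congr_deriv ?_
    field_simp

theorem abs_sub_le_of_abs_deriv_le_rpow_sub_two {g g' : ℝ → ℝ} {s b B p : ℝ} (hs : 0 < s)
    (hsb : s ≤ b) (hp : p < 1) (hB : 0 ≤ B) (hg : ∀ t ∈ Set.Icc s b, HasDerivAt g (g' t) t)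
    (h : ∀ t ∈ Set.Icc s b, |g' t| ≤ B * t ^ (p - 2)) :
    |g b - g s| ≤ B * s ^ (p - 1) / (1 - p) := by
  have hp' : 0 < 1 - p := by linarith
  have := abs_sub_le_sub_of_abs_deriv_le (G := fun t => -(B * t ^ (p - 1) / (1 - p)))
    (G' := fun t => B * t ^ (p - 2)) hsb hg (fun t ht => ?_) h
  · have hb : 0 < b := hs.trans_le hsb
    have : 0 ≤ B * b ^ (p - 1) / (1 - p) := by positivity
    linarith
  · have ht0 : 0 < t := hs.trans_le ht.1
    refine (((Real.hasDerivAt_rpow_const (p := p - 1) (Or.inl ht0.ne')).const_mul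
      B).div_const (1 - p)).neg.congr_deriv ?_
    rw [show p - 1 - 1 = p - 2 by ring]
    field_simp
    ring

section Estimates

variable {E : Type*} [NormedAddCommGroup E] [InnerProductSpace ℝ E] [FiniteDimensional ℝ E]
  [MeasurableSpace E] [BorelSpace E]

/-- `κ` bounds the `L¹` norm of `K` and the `L¹` modulus of continuity of `K` under translations
by vectors of length at most one. -/
structure KernelBound (K : E → ℝ) (κ : ℝ) : Prop where
  nonneg : 0 ≤ κ
  integral_abs_le : ∫ z, |K z| ≤ κ
  integral_abs_sub_le : ∀ h : E, ‖h‖ ≤ 1 → ∫ z, |K z - K (z - h)| ≤ κ * ‖h‖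

theorem KernelBound.mono {K : E → ℝ} {κ κ' : ℝ} (h : KernelBound K κ) (hκ : κ ≤ κ') :
    KernelBound K κ' where
  nonneg := h.nonneg.trans hκ
  integral_abs_le := h.integral_abs_le.trans hκ
  integral_abs_sub_le v hv := (h.integral_abs_sub_le v hv).trans (by gcongr)

theorem IsKernel.integrable_sub_comp {K : E → ℝ} (hK : IsKernel K) (h : E) :
    Integrable fun z => K z - K (z - h) :=
  hK.integrable.sub (hK.integrable.comp_sub_right h)

theorem IsKernel.exists_kernelBound {K : E → ℝ} (hK : IsKernel K) : ∃ κ, KernelBound K κ := by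
  obtain ⟨C, hC⟩ := hK.smooth.lipschitzWith_of_hasCompactSupport hK.hasCompactSupport (by simp)
  refine ⟨max (∫ z, |K z|) (C * volume.real (closedBall (0 : E) 2)), ?_, le_max_left _ _,
    fun h hh => ?_⟩
  · exact (integral_nonneg fun z => abs_nonneg _).trans (le_max_left _ _)
  · have hle : ∫ z, |K z - K (z - h)| ≤
        ∫ z, (closedBall (0 : E) 2).indicator (fun _ => C * ‖h‖) z := by
      refine integral_mono (hK.integrable_sub_comp h).abs
        ((integrable_indicator_iff measurableSet_closedBall).2
          (integrableOn_const (isCompact_closedBall (0 : E) 2).measure_ne_top)) fun z => ?_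
      dsimp only
      by_cases hz : z ∈ closedBall (0 : E) 2
      · rw [Set.indicator_of_mem hz]
        have := hC.dist_le_mul z (z - h)
        rwa [Real.dist_eq, dist_eq_norm, sub_sub_cancel] at this
      · rw [Set.indicator_of_notMem hz]
        rw [mem_closedBall_zero_iff, not_le] at hz
        rw [hK.sub_comp_eq_zero hh hz, abs_zero]
    refine hle.trans ?_
    rw [integral_indicator_const _ measurableSet_closedBall, smul_eq_mul]
    calc volume.real (closedBall (0 : E) 2) * (C * ‖h‖)
        = C * volume.real (closedBall (0 : E) 2) * ‖h‖ := by ring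
      _ ≤ _ := by gcongr; exact le_max_right _ _

theorem abs_integral_mul_le {w k : E → ℝ} {M r : ℝ} (hk : Integrable k)
    (hk0 : ∀ z, r < ‖z‖ → k z = 0) (hw : ∀ z, ‖z‖ ≤ r → |w z| ≤ M) :
    |∫ z, w z * k z| ≤ M * ∫ z, |k z| := by
  rw [← integral_const_mul, ← Real.norm_eq_abs]
  refine norm_integral_le_of_norm_le (hk.abs.const_mul M) (Eventually.of_forall fun z => ?_)
  rw [Real.norm_eq_abs, abs_mul]
  rcases le_or_gt ‖z‖ r with hz | hz
  · gcongr
    exact hw z hz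
  · simp [hk0 z hz]

theorem KernelBound.abs_integral_le {K w : E → ℝ} {κ M t : ℝ} {x : E} (hκ : KernelBound K κ)
    (hK : IsKernel K) (ht : 0 < t) (hw : ∀ v, ‖v‖ ≤ t → |w (x + v)| ≤ M) :
    |∫ z, w (x + t • z) * K z| ≤ κ * M := by
  have hM : 0 ≤ M := (abs_nonneg _).trans (hw 0 (by simpa using ht.le))
  refine (abs_integral_mul_le (r := 1) (M := M) hK.integrable (fun z hz => hK.eq_zero hz)
    fun z hz => hw _ ?_).trans ?_
  · rw [norm_smul, Real.norm_of_nonneg ht.le]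
    nlinarith
  · rw [mul_comm]
    gcongr
    exact hκ.integral_abs_le

/-- Moving the centre of an average costs a factor `‖x - y‖ / t`: the two averages are integrals of
`w (x + t z)` against kernels that differ by the translation `(y - x) / t`. -/
theorem KernelBound.abs_integral_sub_integral_le {K w : E → ℝ} {κ M t : ℝ} {x y : E}
    (hκ : KernelBound K κ) (hK : IsKernel K) (hwc : Continuous w) (ht : 0 < t)
    (hxy : ‖x - y‖ ≤ t) (hw : ∀ v, ‖v‖ ≤ 2 * t → |w (x + v)| ≤ M) :
    |(∫ z, w (x + t • z) * K z) - ∫ z, w (y + t • z) * K z| ≤ κ * M * (‖x - y‖ / t) := by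
  have hM : 0 ≤ M := (abs_nonneg _).trans (hw 0 (by simpa using ht.le))
  set h : E := t⁻¹ • (y - x) with hh
  have hn : ‖h‖ = ‖x - y‖ / t := by
    rw [hh, norm_smul, norm_inv, Real.norm_of_nonneg ht.le, norm_sub_rev]
    field_simp
  have hn1 : ‖h‖ ≤ 1 := by rwa [hn, div_le_one ht]
  have hxh (z : E) : y + t • z = x + t • (z + h) := by
    rw [hh, smul_add, smul_smul, mul_inv_cancel₀ ht.ne', one_smul]
    abel
  have e1 : ∫ z, w (y + t • z) * K z = ∫ z, w (x + t • z) * K (z - h) := by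
    rw [← integral_add_right_eq_self (fun z => w (x + t • z) * K (z - h)) h]
    simp_rw [hxh, add_sub_cancel_right]
  have hi : Integrable fun z => w (x + t • z) * K (z - h) := by
    have := (hK.integrable_mul hwc y t).comp_sub_right h
    refine this.congr (Eventually.of_forall fun z => ?_)
    simp only [hxh, sub_add_cancel]
  rw [e1, ← integral_sub (hK.integrable_mul hwc x t) hi]
  simp_rw [← mul_sub]
  refine (abs_integral_mul_le (r := 2) (M := M) (hK.integrable_sub_comp h)
    (fun z hz => hK.sub_comp_eq_zero hn1 hz) fun z hz => hw _ ?_).trans ?_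
  · rw [norm_smul, Real.norm_of_nonneg ht.le]
    nlinarith
  · rw [← hn, mul_comm κ, mul_assoc]
    gcongr
    exact hκ.integral_abs_sub_le h hn1

theorem IsKernel.integral_sub_const_mul {K w : E → ℝ} (hK : IsKernel K) (hK0 : ∫ z, K z = 0)
    (hw : Continuous w) (c : ℝ) (x : E) (t : ℝ) :
    ∫ z, (w (x + t • z) - c) * K z = ∫ z, w (x + t • z) * K z := by
  simp_rw [sub_mul]
  rw [integral_sub (hK.integrable_mul hw x t) (hK.integrable.const_mul c), integral_const_mul,
    hK0, mul_zero, sub_zero]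

theorem abs_hessAvg_le {u : E → ℝ} {a a' x : E} {κ S R : ℝ}
    (hκ : KernelBound (dirD a (dirD a' (radialMass : E → ℝ))) κ) (hR : 0 < R)
    (hS : ∀ v, ‖v‖ ≤ R → |u (x + v)| ≤ S) : |hessAvg a a' u x R| ≤ κ * (S / R ^ 2) := by
  have h := hκ.abs_integral_le ((isKernel_radialMass.isKernel_dirD a').isKernel_dirD a) hR hS
  rw [hessAvg, abs_mul, abs_of_nonneg (by positivity)]
  calc (R ^ 2)⁻¹ * _ ≤ (R ^ 2)⁻¹ * (κ * S) := by gcongr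
    _ = _ := by field_simp

theorem abs_deriv_hessAvg_le {u : E → ℝ} (hu : ContDiff ℝ 2 u) {a a' x : E} {κ B R α t : ℝ}
    (hκ : KernelBound (dirD a (dirD a' (radialBump : E → ℝ))) κ) (hα : 0 < α) (hB0 : 0 ≤ B)
    (hB : ∀ v, ‖v‖ ≤ R → |(Δ u) (x + v) - (Δ u) x| ≤ B * ‖v‖ ^ α) (ht : t ∈ Set.Ioc 0 R) :
    |t⁻¹ * ∫ z, (Δ u) (x + t • z) * dirD a (dirD a' radialBump) z| ≤
      κ * B * t ^ (α - 1) := by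
  have hL : IsKernel (dirD a (dirD a' (radialBump : E → ℝ))) :=
    (isKernel_radialBump.isKernel_dirD a').isKernel_dirD a
  have hL0 := (isKernel_radialBump (E := E).isKernel_dirD a').integral_dirD a
  have ht0 : 0 < t := ht.1
  have h := hκ.abs_integral_le (x := x) (w := fun y => (Δ u) y - (Δ u) x) (M := B * t ^ α) hL ht.1
    fun v hv => (hB v (hv.trans ht.2)).trans (by gcongr)
  rw [hL.integral_sub_const_mul hL0 (continuous_laplacian hu)] at h
  rw [abs_mul, abs_of_pos (inv_pos.2 ht0), Real.rpow_sub_one ht0.ne']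
  calc t⁻¹ * _ ≤ t⁻¹ * (κ * (B * t ^ α)) := by gcongr
    _ = _ := by field_simp

theorem abs_hessAvg_sub_le {u : E → ℝ} (hu : ContDiff ℝ 2 u) {a a' x : E} {κ B R α : ℝ}
    (hκ : KernelBound (dirD a (dirD a' (radialBump : E → ℝ))) κ) (hR : 0 < R) (hα : 0 < α)
    (hB0 : 0 ≤ B) (hB : ∀ v, ‖v‖ ≤ R → |(Δ u) (x + v) - (Δ u) x| ≤ B * ‖v‖ ^ α) :
    |hessAvg a a' u x R - dirD a (dirD a' u) x * massConst E| ≤ κ * B * R ^ α / α :=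
  abs_sub_le_of_abs_deriv_le_rpow hR hα (mul_nonneg hκ.nonneg hB0)
    (fun _ ht => hasDerivAt_hessAvg hu a a' x (ne_of_gt ht.1))
    (fun _ ht => abs_deriv_hessAvg_le hu hκ hα hB0 hB ht) (tendsto_hessAvg hu a a' x)

/-- Interior bound for the second derivatives of `u` in terms of `u` and the Hölder modulus of `Δu`
at a single point. -/
theorem abs_dirD_dirD_le {u : E → ℝ} (hu : ContDiff ℝ 2 u) {a a' x : E} {κ S B R α : ℝ}
    (hκ' : KernelBound (dirD a (dirD a' (radialMass : E → ℝ))) κ)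
    (hκ : KernelBound (dirD a (dirD a' (radialBump : E → ℝ))) κ) (hR : 0 < R) (hα : 0 < α)
    (hB0 : 0 ≤ B) (hS : ∀ v, ‖v‖ ≤ R → |u (x + v)| ≤ S)
    (hB : ∀ v, ‖v‖ ≤ R → |(Δ u) (x + v) - (Δ u) x| ≤ B * ‖v‖ ^ α) :
    |dirD a (dirD a' u) x * massConst E| ≤ κ * (S / R ^ 2 + B * R ^ α / α) := by
  have h1 := abs_hessAvg_le hκ' hR hS
  have h2 := abs_hessAvg_sub_le hu hκ hR hα hB0 hB
  rw [show κ * B * R ^ α / α = κ * (B * R ^ α / α) by ring] at h2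
  rw [mul_add]
  rw [abs_le] at *
  constructor <;> linarith

/-- Interior bound for the difference of the second derivatives of `u` at two points `x`, `y`, in
terms of `u` and the Hölder moduli of `Δu` at `x` and at `y`; the exponents at `x` and `y` may
differ. -/
theorem abs_dirD_dirD_sub_le {u : E → ℝ} (hu : ContDiff ℝ 2 u) {a a' x y : E}
    {κ S B B' R α β δ : ℝ}
    (hκ' : KernelBound (dirD a (dirD a' (radialMass : E → ℝ))) κ)
    (hκ : KernelBound (dirD a (dirD a' (radialBump : E → ℝ))) κ)
    (hxy : ‖x - y‖ = δ) (hδ : 0 < δ) (hδR : δ ≤ R) (hα : 0 < α) (hα1 : α < 1) (hβ : 0 < β)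
    (hB0 : 0 ≤ B) (hB0' : 0 ≤ B') (hS : ∀ v, ‖v‖ ≤ 2 * R → |u (x + v)| ≤ S)
    (hB : ∀ v, ‖v‖ ≤ 2 * R → |(Δ u) (x + v) - (Δ u) x| ≤ B * ‖v‖ ^ α)
    (hB' : ∀ v, ‖v‖ ≤ R → |(Δ u) (y + v) - (Δ u) y| ≤ B' * ‖v‖ ^ β) :
    |dirD a (dirD a' u) x * massConst E - dirD a (dirD a' u) y * massConst E| ≤
      κ * (S * δ / R ^ 3 + 2 * B * δ ^ α / (1 - α) + B * δ ^ α / α + B' * δ ^ β / β) := by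
  have hR : 0 < R := hδ.trans_le hδR
  have hκ0 := hκ.nonneg
  have hK : IsKernel (dirD a (dirD a' (radialMass : E → ℝ))) :=
    (isKernel_radialMass.isKernel_dirD a').isKernel_dirD a
  have hL : IsKernel (dirD a (dirD a' (radialBump : E → ℝ))) :=
    (isKernel_radialBump.isKernel_dirD a').isKernel_dirD a
  have hL0 := (isKernel_radialBump (E := E).isKernel_dirD a').integral_dirD a
  have hx := abs_hessAvg_sub_le hu hκ hδ hα hB0 fun v hv => hB v (by linarith)
  have hy := abs_hessAvg_sub_le hu hκ hδ hβ hB0' fun v hv => hB' v (by linarith)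
  have htop : |hessAvg a a' u x R - hessAvg a a' u y R| ≤ κ * (S * δ / R ^ 3) := by
    have h := hκ'.abs_integral_sub_integral_le hK hu.continuous hR (hxy.trans_le hδR) hS
    rw [hessAvg, hessAvg, ← mul_sub, abs_mul, abs_of_nonneg (by positivity)]
    calc (R ^ 2)⁻¹ * _ ≤ (R ^ 2)⁻¹ * (κ * S * (‖x - y‖ / R)) := by gcongr
      _ = _ := by rw [hxy]; field_simp
  -- Between the scales `δ` and `R` the two averages are compared through the regularity of the
  -- kernel, which gains a factor `δ / t` and makes the derivative integrable at infinity.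
  have hmid := abs_sub_le_of_abs_deriv_le_rpow_sub_two (p := α) (B := κ * (2 * B) * δ) hδ hδR hα1
    (by positivity)
    (fun t ht => (hasDerivAt_hessAvg hu a a' x (hδ.trans_le ht.1).ne').sub
      (hasDerivAt_hessAvg hu a a' y (hδ.trans_le ht.1).ne')) fun t ht => by
    have ht0 : 0 < t := hδ.trans_le ht.1
    have h := hκ.abs_integral_sub_integral_le (w := fun z => (Δ u) z - (Δ u) x)
      (M := 2 * B * t ^ α) (x := x) (y := y) hL ((continuous_laplacian hu).sub continuous_const)
      ht0 (hxy.trans_le ht.1) fun v hv => by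
        refine (hB v (by linarith [ht.2])).trans ?_
        calc B * ‖v‖ ^ α ≤ B * (2 * t) ^ α := by gcongr
          _ = 2 ^ α * B * t ^ α := by rw [Real.mul_rpow zero_le_two ht0.le]; ring
          _ ≤ _ := by
            gcongr
            simpa using Real.rpow_le_rpow_of_exponent_le one_le_two hα1.le
    rw [hL.integral_sub_const_mul hL0 (continuous_laplacian hu),
      hL.integral_sub_const_mul hL0 (continuous_laplacian hu), hxy] at h
    rw [← mul_sub, abs_mul, abs_of_pos (inv_pos.2 ht0), Real.rpow_sub ht0, Real.rpow_two]
    calc t⁻¹ * _ ≤ t⁻¹ * (κ * (2 * B * t ^ α) * (δ / t)) := by gcongr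
      _ = _ := by field_simp
  have e : κ * (2 * B) * δ * δ ^ (α - 1) / (1 - α) = κ * (2 * B * δ ^ α / (1 - α)) := by
    rw [Real.rpow_sub_one hδ.ne']
    field_simp
  rw [e] at hmid
  rw [show κ * B * δ ^ α / α = κ * (B * δ ^ α / α) by ring] at hx
  rw [show κ * B' * δ ^ β / β = κ * (B' * δ ^ β / β) by ring] at hy
  simp only [Pi.sub_apply] at hmid
  rw [mul_add, mul_add, mul_add]
  rw [abs_le] at *
  constructor <;> linarith

end Estimates

/-! ### Localization to an open set -/


section Localization

variable {E : Type*} [NormedAddCommGroup E] [InnerProductSpace ℝ E]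

theorem dirD_congr {f g : E → ℝ} {x : E} (h : f =ᶠ[𝓝 x] g) (a : E) :
    dirD a f =ᶠ[𝓝 x] dirD a g := by
  filter_upwards [h.fderiv (𝕜 := ℝ)] with y hy
  rw [dirD, hy, dirD]

/-- A `C²` function on an open set agrees with a `C²` function on the whole space near a smaller
ball. -/
theorem exists_contDiff_eventuallyEq [FiniteDimensional ℝ E] {Ω : Set E} {u : E → ℝ} {x : E}
    {r d : ℝ} (hΩ : IsOpen Ω) (hu : ContDiffOn ℝ 2 u Ω) (hr : 0 < r) (hrd : r < d)
    (hd : ball x d ⊆ Ω) :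
    ∃ v : E → ℝ, ContDiff ℝ 2 v ∧ ∀ z ∈ closedBall x r, v =ᶠ[𝓝 z] u := by
  let χ : ContDiffBump x := ⟨(2 * r + d) / 3, (r + 2 * d) / 3, by linarith, by linarith⟩
  refine ⟨fun z => χ z * u z, contDiff_iff_contDiffAt.2 fun z => ?_, fun z hz => ?_⟩
  · by_cases hz : z ∈ Ω
    · exact χ.contDiffAt.mul (hu.contDiffAt (hΩ.mem_nhds hz))
    · have h0 : (fun z => χ z * u z) =ᶠ[𝓝 z] fun _ => 0 := by
        have hz' : z ∉ tsupport χ := by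
          rw [χ.tsupport_eq]
          intro h
          refine hz (hd (closedBall_subset_ball ?_ h))
          change (r + 2 * d) / 3 < d
          linarith
        filter_upwards [notMem_tsupport_iff_eventuallyEq.1 hz'] with y hy
        simp [hy]
      exact contDiffAt_const.congr_of_eventuallyEq h0
  · have hz' : z ∈ ball x χ.rIn := closedBall_subset_ball
      (show r < (2 * r + d) / 3 by linarith) hz
    filter_upwards [χ.eventuallyEq_one_of_mem_ball hz'] with y hy
    simp [hy]

end Localization

section BoundaryDistance

variable {n : ℕ} {Ω : Set (EuclideanSpace ℝ (Fin n))} {x y : EuclideanSpace ℝ (Fin n)}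

theorem ball_bdist_subset (ho : IsOpen Ω) (hx : x ∈ Ω) : ball x (bdist Ω x) ⊆ Ω := by
  rcases le_or_gt (bdist Ω x) 0 with h | hpos
  · simp [ball_eq_empty.2 h]
  refine (convex_ball x _).isPreconnected.subset_left_of_subset_union ho
    isClosed_closure.isOpen_compl (disjoint_compl_right.mono_left subset_closure)
    (fun z hz => ?_) ⟨x, mem_ball_self hpos, hx⟩
  by_contra h
  rw [Set.mem_union, Set.mem_compl_iff, not_or, not_not] at h
  have hzf : z ∈ frontier Ω := by
    rw [ho.frontier_eq]
    exact ⟨h.2, h.1⟩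
  have := infDist_le_dist_of_mem (x := x) hzf
  rw [mem_ball, dist_comm] at hz
  exact absurd hz (not_lt.2 this)

theorem bdist_le_add_dist : bdist Ω x ≤ bdist Ω y + dist x y :=
  infDist_le_infDist_add_dist

theorem frontier_nonempty (hn : 1 ≤ n) (hb : Bornology.IsBounded Ω) (hx : x ∈ Ω) :
    (frontier Ω).Nonempty := by
  have : Nonempty (Fin n) := ⟨⟨0, hn⟩⟩
  refine nonempty_frontier_iff.2 ⟨⟨x, hx⟩, fun h => ?_⟩
  rw [h] at hb
  exact NormedSpace.unbounded_univ ℝ (EuclideanSpace ℝ (Fin n)) hb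

theorem bdist_pos (hn : 1 ≤ n) (ho : IsOpen Ω) (hb : Bornology.IsBounded Ω) (hx : x ∈ Ω) :
    0 < bdist Ω x := by
  refine (isClosed_frontier.notMem_iff_infDist_pos (frontier_nonempty hn hb hx)).1 fun h => ?_
  rw [ho.frontier_eq] at h
  exact h.2 hx

theorem bdist_le_diam (hn : 1 ≤ n) (hb : Bornology.IsBounded Ω) (hx : x ∈ Ω) :
    bdist Ω x ≤ diam Ω := by
  obtain ⟨w, hw⟩ := frontier_nonempty hn hb hx
  refine (infDist_le_dist_of_mem hw).trans ?_
  rw [← diam_closure]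
  exact dist_le_diam_of_mem hb.closure (subset_closure hx) (frontier_subset_closure hw)

end BoundaryDistance

section Interior

variable {n : ℕ} {Ω : Set (EuclideanSpace ℝ (Fin n))} {α u f : EuclideanSpace ℝ (Fin n) → ℝ}
  {S N : ℝ}

/-- `u` is a solution of `Δu = f` in `Ω` for which `S` bounds `|u|` and `N` bounds the weighted
Hölder quotients of `f`. -/
structure PoissonBounds (Ω : Set (EuclideanSpace ℝ (Fin n)))
    (α u f : EuclideanSpace ℝ (Fin n) → ℝ) (S N : ℝ) : Prop where
  isOpen : IsOpen Ω
  contDiffOn : ContDiffOn ℝ 2 u Ω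
  laplacian_eq : ∀ x ∈ Ω, (Δ u) x = f x
  nonneg : 0 ≤ N
  abs_le : ∀ x ∈ Ω, |u x| ≤ S
  quotient_le : ∀ x ∈ Ω, ∀ y ∈ Ω, x ≠ y →
    bdist₂ Ω x y ^ (α x + 2) * (|f x - f y| / dist x y ^ α x) ≤ N

/-- The weighted bound on `f` gives a Hölder modulus at `x`, with a constant that is uniform on the
ball of radius `d / 2`, since the distance to the boundary is at least `d / 2` there. -/
theorem PoissonBounds.abs_sub_le (h : PoissonBounds Ω α u f S N) {x v : EuclideanSpace ℝ (Fin n)}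
    {d : ℝ} (hx : x ∈ Ω) (hd : 0 < d) (hdx : d ≤ bdist Ω x) (hα : 0 < α x) (hv : ‖v‖ ≤ d / 2) :
    x + v ∈ Ω ∧ |f (x + v) - f x| ≤ N / (d / 2) ^ (α x + 2) * ‖v‖ ^ α x := by
  have hmem : x + v ∈ Ω := ball_bdist_subset h.isOpen hx (by
    rw [mem_ball, dist_self_add_left]
    linarith)
  refine ⟨hmem, ?_⟩
  rcases eq_or_ne v 0 with rfl | hv0
  · simp [Real.zero_rpow hα.ne']
  have hvpos : 0 < ‖v‖ := norm_pos_iff.2 hv0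
  have h1 := h.quotient_le x hx (x + v) hmem (by simpa using hv0)
  have hdist : dist x (x + v) = ‖v‖ := by simp [dist_eq_norm]
  have hle : d / 2 ≤ bdist₂ Ω x (x + v) := by
    have := bdist_le_add_dist (Ω := Ω) (x := x) (y := x + v)
    rw [hdist] at this
    exact le_min (by linarith) (by linarith)
  rw [hdist, abs_sub_comm] at h1
  have h2 : (d / 2) ^ (α x + 2) * (|f (x + v) - f x| / ‖v‖ ^ α x) ≤ N :=
    le_trans (by gcongr) h1
  have hp : 0 < (d / 2) ^ (α x + 2) := by positivity
  have hq : 0 < ‖v‖ ^ α x := by positivity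
  rw [mul_div_assoc', div_le_iff₀ hq] at h2
  rw [div_mul_eq_mul_div, le_div_iff₀ hp]
  linarith

/-- The localized solution: a `C²` function on the whole space with the same second derivatives as
`u` on the ball of radius `d / 2`, hence with `Δv = f` there. -/
theorem PoissonBounds.exists_contDiff (h : PoissonBounds Ω α u f S N)
    {x : EuclideanSpace ℝ (Fin n)} {d : ℝ} (hx : x ∈ Ω) (hd : 0 < d) (hdx : d ≤ bdist Ω x) :
    ∃ v : EuclideanSpace ℝ (Fin n) → ℝ, ContDiff ℝ 2 v ∧
      ∀ z ∈ closedBall x (d / 2), |v z| ≤ S ∧ (Δ v) z = f z ∧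
        ∀ a a', dirD a (dirD a' v) z = dirD a (dirD a' u) z := by
  have hball : ball x d ⊆ Ω := (ball_subset_ball hdx).trans (ball_bdist_subset h.isOpen hx)
  obtain ⟨v, hv, hvu⟩ := exists_contDiff_eventuallyEq h.isOpen h.contDiffOn (half_pos hd)
    (half_lt_self hd) hball
  refine ⟨v, hv, fun z hz => ?_⟩
  have hzΩ : z ∈ Ω := hball (closedBall_subset_ball (half_lt_self hd) hz)
  refine ⟨?_, ?_, fun a a' => ?_⟩
  · rw [(hvu z hz).eq_of_nhds]
    exact h.abs_le z hzΩ
  · rw [(InnerProductSpace.laplacian_congr_nhds (hvu z hz)).eq_of_nhds, h.laplacian_eq z hzΩ]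
  · exact (dirD_congr (dirD_congr (hvu z hz) a') a).eq_of_nhds

/-- The scaling of `N / (d / 2) ^ (γ + 2)`, the Hölder constant of `f` on a ball of radius
`d / 2`. -/
theorem div_rpow_mul_rpow_eq {N d δ γ : ℝ} (hd : 0 < d) (hδ : 0 < δ) :
    N / (d / 2) ^ (γ + 2) * δ ^ γ = 2 ^ γ * (4 * N / d ^ 2 * (δ / d) ^ γ) := by
  rw [Real.rpow_add (half_pos hd), Real.div_rpow hd.le zero_le_two, Real.div_rpow hδ.le hd.le,
    Real.rpow_two]
  field_simp
  ring

theorem PoissonBounds.abs_dirD_dirD_le (h : PoissonBounds Ω α u f S N)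
    {a a' x : EuclideanSpace ℝ (Fin n)} {κ d m : ℝ}
    (hκ' : KernelBound (dirD a (dirD a' (radialMass : EuclideanSpace ℝ (Fin n) → ℝ))) κ)
    (hκ : KernelBound (dirD a (dirD a' (radialBump : EuclideanSpace ℝ (Fin n) → ℝ))) κ)
    (hx : x ∈ Ω) (hd : 0 < d) (hdx : d ≤ bdist Ω x) (hm : 0 < m) (hα : m ≤ α x) :
    d ^ 2 * |dirD a (dirD a' u) x * massConst (EuclideanSpace ℝ (Fin n))| ≤
      κ * (4 * S + 4 / m * N) := by
  obtain ⟨v, hv, hvu⟩ := h.exists_contDiff hx hd hdx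
  have hα0 : 0 < α x := hm.trans_le hα
  have hN := h.nonneg
  have hκ0 := hκ.nonneg
  have hmem {w : EuclideanSpace ℝ (Fin n)} (hw : ‖w‖ ≤ d / 2) : x + w ∈ closedBall x (d / 2) := by
    simpa [mem_closedBall, dist_self_add_left] using hw
  have hxm : x ∈ closedBall x (d / 2) := mem_closedBall_self (by linarith)
  have h1 := VarHolder.abs_dirD_dirD_le hv hκ' hκ (x := x) (half_pos hd) hα0
    (B := N / (d / 2) ^ (α x + 2)) (by positivity) (fun w hw => (hvu _ (hmem hw)).1) fun w hw => by
      rw [(hvu _ (hmem hw)).2.1, (hvu x hxm).2.1]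
      exact (h.abs_sub_le hx hd hdx hα0 hw).2
  rw [(hvu x hxm).2.2, div_rpow_mul_rpow_eq hd (half_pos hd), mul_left_comm,
    ← Real.mul_rpow zero_le_two (by positivity), show 2 * (d / 2 / d) = 1 by field_simp,
    Real.one_rpow] at h1
  calc d ^ 2 * _ ≤ d ^ 2 * (κ * (S / (d / 2) ^ 2 + 4 * N / d ^ 2 * 1 / α x)) := by gcongr
    _ = κ * (4 * S + 4 * N / α x) := by field_simp; ring
    _ ≤ κ * (4 * S + 4 * N / m) := by gcongr
    _ = _ := by ring

/-- The weighted Hölder bound for the second derivatives at points that are close relative to their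
distance `d` to the boundary. The change of exponent from `α y` to `α x` enters through `Q`. -/
theorem PoissonBounds.abs_dirD_dirD_sub_le (h : PoissonBounds Ω α u f S N)
    {a a' x y : EuclideanSpace ℝ (Fin n)} {κ d δ m M Q : ℝ}
    (hκ' : KernelBound (dirD a (dirD a' (radialMass : EuclideanSpace ℝ (Fin n) → ℝ))) κ)
    (hκ : KernelBound (dirD a (dirD a' (radialBump : EuclideanSpace ℝ (Fin n) → ℝ))) κ)
    (hx : x ∈ Ω) (hy : y ∈ Ω) (hdx : d ≤ bdist Ω x) (hdy : d ≤ bdist Ω y)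
    (hδ : dist x y = δ) (hδ0 : 0 < δ) (hδd : δ ≤ d / 4) (hm : 0 < m) (hM : M < 1)
    (hαx : α x ∈ Set.Icc m M) (hαy : α y ∈ Set.Icc m M)
    (hQ : (δ / d) ^ α y ≤ Q * (δ / d) ^ α x) :
    d ^ (2 + α x) * (|dirD a (dirD a' u) x * massConst (EuclideanSpace ℝ (Fin n)) -
        dirD a (dirD a' u) y * massConst (EuclideanSpace ℝ (Fin n))| / δ ^ α x) ≤
      κ * (64 * S + (16 / (1 - M) + 8 / m + 8 * Q / m) * N) := by
  have hd : 0 < d := by linarith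
  obtain ⟨v, hv, hvu⟩ := h.exists_contDiff hx hd hdx
  have hαx0 : 0 < α x := hm.trans_le hαx.1
  have hαy0 : 0 < α y := hm.trans_le hαy.1
  have hαx1 : α x < 1 := hαx.2.trans_lt hM
  have hαy1 : α y < 1 := hαy.2.trans_lt hM
  have hN := h.nonneg
  have hS : 0 ≤ S := (abs_nonneg _).trans (h.abs_le x hx)
  have hκ0 := hκ.nonneg
  have hM0 : 0 < 1 - M := by linarith
  have hm0 : 0 < 1 - α x := by linarith
  have hmem {w : EuclideanSpace ℝ (Fin n)} (hw : ‖w‖ ≤ 2 * (d / 4)) :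
      x + w ∈ closedBall x (d / 2) := by
    rw [mem_closedBall, dist_self_add_left]
    linarith
  have hmemy {w : EuclideanSpace ℝ (Fin n)} (hw : ‖w‖ ≤ d / 4) :
      y + w ∈ closedBall x (d / 2) := by
    rw [mem_closedBall]
    have h1 := dist_triangle (y + w) y x
    rw [dist_self_add_left, dist_comm y x, hδ] at h1
    linarith
  have hxm : x ∈ closedBall x (d / 2) := mem_closedBall_self (by linarith)
  have hym : y ∈ closedBall x (d / 2) := by
    simpa using hmemy (w := 0) (by rw [norm_zero]; positivity)
  have h1 := VarHolder.abs_dirD_dirD_sub_le hv hκ' hκ (x := x) (y := y) (R := d / 4)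
    (B := N / (d / 2) ^ (α x + 2)) (B' := N / (d / 2) ^ (α y + 2)) (S := S)
    ((dist_eq_norm x y).symm.trans hδ) hδ0 hδd hαx0 hαx1 hαy0 (by positivity) (by positivity)
    (fun w hw => (hvu _ (hmem hw)).1)
    (fun w hw => by
      rw [(hvu _ (hmem hw)).2.1, (hvu x hxm).2.1]
      exact (h.abs_sub_le hx hd hdx hαx0 (by linarith)).2)
    (fun w hw => by
      rw [(hvu _ (hmemy hw)).2.1, (hvu y hym).2.1]
      exact (h.abs_sub_le hy hd hdy hαy0 (by linarith)).2)
  rw [(hvu x hxm).2.2, (hvu y hym).2.2] at h1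
  set s := δ / d with hs
  have hs0 : 0 < s := by positivity
  have hs1 : s ≤ 1 := by rw [hs, div_le_one hd]; linarith
  have hδs : δ = s * d := by rw [hs]; field_simp
  have hsx : 0 < s ^ α x := by positivity
  have htwo {γ : ℝ} (hγ : γ < 1) : (2 : ℝ) ^ γ ≤ 2 := by
    simpa using Real.rpow_le_rpow_of_exponent_le one_le_two hγ.le
  have b1 : N / (d / 2) ^ (α x + 2) * δ ^ α x ≤ 8 * N / d ^ 2 * s ^ α x := by
    rw [div_rpow_mul_rpow_eq hd hδ0]
    calc _ ≤ 2 * (4 * N / d ^ 2 * s ^ α x) := by gcongr; exact htwo hαx1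
      _ = _ := by ring
  have b2 : N / (d / 2) ^ (α y + 2) * δ ^ α y ≤ 8 * Q * N / d ^ 2 * s ^ α x := by
    rw [div_rpow_mul_rpow_eq hd hδ0]
    calc _ ≤ 2 * (4 * N / d ^ 2 * (Q * s ^ α x)) := by gcongr; exact htwo hαy1
      _ = _ := by ring
  have b3 : S * δ / (d / 4) ^ 3 ≤ 64 * S / d ^ 2 * s ^ α x := by
    have : s ≤ s ^ α x := by
      simpa using Real.rpow_le_rpow_of_exponent_ge hs0 hs1 hαx1.le
    calc _ = 64 * S / d ^ 2 * s := by rw [hδs]; field_simp; ring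
      _ ≤ _ := by gcongr
  have hQ0 : 0 ≤ Q := by
    have : 0 < Q * s ^ α x := lt_of_lt_of_le (by positivity) hQ
    exact (pos_of_mul_pos_left this hsx.le).le
  have e : d ^ (2 + α x) / δ ^ α x = d ^ 2 / s ^ α x := by
    rw [Real.rpow_add hd, Real.rpow_two, hs, Real.div_rpow hδ0.le hd.le]
    field_simp
  rw [mul_div_assoc', mul_div_right_comm, e]
  calc d ^ 2 / s ^ α x * _ ≤ d ^ 2 / s ^ α x * (κ * (64 * S / d ^ 2 * s ^ α x +
        2 * (8 * N / d ^ 2 * s ^ α x) / (1 - M) + 8 * N / d ^ 2 * s ^ α x / m +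
        8 * Q * N / d ^ 2 * s ^ α x / m)) := by
        gcongr
        refine h1.trans ?_
        rw [mul_assoc 2]
        gcongr
        · exact hαx.2
        · exact hαx.1
        · exact hαy.1
    _ = _ := by field_simp; ring

/-- Interpolation: a first derivative is controlled by the function and a bound `H` for the second
derivative along a segment of length `r`. -/
theorem abs_deriv_le_of_abs_deriv2_le {p p' p'' : ℝ → ℝ} {r S H : ℝ} (hr : 0 < r)
    (hp : ∀ s ∈ Set.Icc 0 r, HasDerivAt p (p' s) s)
    (hp' : ∀ s ∈ Set.Icc 0 r, HasDerivAt p' (p'' s) s)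
    (hS : ∀ s ∈ Set.Icc 0 r, |p s| ≤ S) (hH : ∀ s ∈ Set.Icc 0 r, |p'' s| ≤ H) :
    |p' 0| ≤ 2 * S / r + H * r := by
  obtain ⟨ξ, hξ, hξe⟩ := exists_hasDerivAt_eq_slope p p' hr
    (fun s hs => (hp s hs).continuousAt.continuousWithinAt)
    fun s hs => hp s (Set.Ioo_subset_Icc_self hs)
  have hH0 : 0 ≤ H := (abs_nonneg _).trans (hH 0 ⟨le_rfl, hr.le⟩)
  have hsub {s : ℝ} (hs : s ∈ Set.Icc 0 ξ) : s ∈ Set.Icc 0 r := ⟨hs.1, hs.2.trans hξ.2.le⟩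
  have h1 := abs_sub_le_sub_of_abs_deriv_le (G := fun s => H * s) (G' := fun _ => H) hξ.1.le
    (fun s hs => hp' s (hsub hs)) (fun s _ => by simpa using (hasDerivAt_id s).const_mul H)
    (fun s hs => hH s (hsub hs))
  have h2 : |p' ξ| ≤ 2 * S / r := by
    rw [hξe, sub_zero, abs_div, abs_of_pos hr]
    gcongr
    refine (abs_sub _ _).trans ?_
    linarith [hS 0 ⟨le_rfl, hr.le⟩, hS r ⟨hr.le, le_rfl⟩]
  have h3 : H * ξ ≤ H * r := by gcongr; exact hξ.2.le
  rw [abs_le] at *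
  constructor <;> linarith

end Interior

/-! ### Exponents, partial derivatives and the norm estimate -/


section Exponents

variable {n : ℕ} {Ω : Set (EuclideanSpace ℝ (Fin n))} {α : EuclideanSpace ℝ (Fin n) → ℝ}

theorem IsLogExponent.mem_Icc (h : IsLogExponent Ω α) {x : EuclideanSpace ℝ (Fin n)}
    (hx : x ∈ Ω) : α x ∈ Set.Icc (expInf Ω α) (expSup Ω α) := by
  constructor
  · refine csInf_le ⟨0, ?_⟩ (Set.mem_image_of_mem α hx)
    rintro _ ⟨y, hy, rfl⟩
    exact (h.mem_Ioc y hy).1.le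
  · refine le_csSup ⟨1, ?_⟩ (Set.mem_image_of_mem α hx)
    rintro _ ⟨y, hy, rfl⟩
    exact (h.mem_Ioc y hy).2

theorem IsLogExponent.logHolderBound_cLog (h : IsLogExponent Ω α) :
    LogHolderBound Ω α (cLog Ω α) := by
  obtain ⟨M, hM, hMb⟩ := h.logHolder
  exact fun x hx y hy => le_csInf ⟨M, hM.le, hMb⟩ fun _ hb => hb.2 x hx y hy

/-- Log-Hölder continuity allows the exponent in a power of `dist x y / d` to be changed from
`α y` to `α x`, at the cost of a factor. -/
theorem LogHolderBound.rpow_le {M D d : ℝ} (h : LogHolderBound Ω α M)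
    (hα : ∀ z ∈ Ω, α z ∈ Set.Ioc (0 : ℝ) 1) {x y : EuclideanSpace ℝ (Fin n)}
    (hx : x ∈ Ω) (hy : y ∈ Ω) (hxy : 0 < dist x y) (hd : dist x y ≤ d) (hdD : d ≤ D) :
    (dist x y / d) ^ α y ≤ max 1 D * Real.exp M * (dist x y / d) ^ α x := by
  have hM := h x hx y hy
  have hd0 : 0 < d := hxy.trans_le hd
  set δ := dist x y
  have hs0 : 0 < δ / d := by positivity
  have hs1 : δ / d ≤ 1 := (div_le_one hd0).2 hd
  have hsx : 0 < (δ / d) ^ α x := by positivity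
  have hM0 : 0 ≤ M := le_trans (by positivity) hM
  rcases le_total (α x) (α y) with hle | hle
  · have h1 : (1 : ℝ) ≤ max 1 D * Real.exp M :=
      one_le_mul_of_one_le_of_one_le (le_max_left _ _) (Real.one_le_exp hM0)
    calc (δ / d) ^ α y ≤ (δ / d) ^ α x := Real.rpow_le_rpow_of_exponent_ge hs0 hs1 hle
      _ ≤ _ := le_mul_of_one_le_left hsx.le h1
  · set γ := α x - α y with hγ
    have hγ0 : 0 ≤ γ := by linarith
    have hγ1 : γ ≤ 1 := by linarith [(hα x hx).2, (hα y hy).1]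
    rw [abs_of_nonneg hγ0] at hM
    have e : (δ / d) ^ α y = d ^ γ * δ ^ (-γ) * (δ / d) ^ α x := by
      rw [show α y = α x - γ by ring, Real.rpow_sub hs0, Real.div_rpow hxy.le hd0.le γ,
        Real.rpow_neg hxy.le]
      field_simp
    have h1 : d ^ γ ≤ max 1 D := by
      calc d ^ γ ≤ max 1 D ^ γ := by gcongr; exact hdD.trans (le_max_right _ _)
        _ ≤ max 1 D ^ (1 : ℝ) := Real.rpow_le_rpow_of_exponent_le (le_max_left _ _) hγ1
        _ = _ := Real.rpow_one _
    have h2 : δ ^ (-γ) ≤ Real.exp M := by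
      rw [Real.rpow_def_of_pos hxy, Real.exp_le_exp]
      nlinarith [neg_abs_le (Real.log δ)]
    rw [e]
    gcongr

end Exponents

section PartialDerivatives

variable {n : ℕ} {u : EuclideanSpace ℝ (Fin n) → ℝ} {x : EuclideanSpace ℝ (Fin n)}

theorem partialD_zero (σ : Fin 0 → Fin n) : partialD σ u x = u x := by
  simp [partialD]

theorem partialD_one (σ : Fin 1 → Fin n) :
    partialD σ u x = dirD (EuclideanSpace.single (σ 0) 1) u x := by
  simp [partialD, dirD]

theorem partialD_two (hu : ContDiffAt ℝ 2 u x) (σ : Fin 2 → Fin n) :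
    partialD σ u x =
      dirD (EuclideanSpace.single (σ 0) 1) (dirD (EuclideanSpace.single (σ 1) 1) u) x := by
  have hd : DifferentiableAt ℝ (fderiv ℝ u) x :=
    (hu.fderiv_right (m := 1) (by norm_num)).differentiableAt one_ne_zero
  change _ = fderiv ℝ (fun y => fderiv ℝ u y _) x _
  rw [partialD, iteratedFDeriv_two_apply, fderiv_clm_apply hd (differentiableAt_const _)]
  simp

/-- One constant serves for all the second-order partial derivatives of the two radial kernels. -/
theorem exists_uniform_kernelBound (n : ℕ) : ∃ κ, ∀ i j : Fin n,
    KernelBound (dirD (EuclideanSpace.single i 1) (dirD (EuclideanSpace.single j 1)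
      (radialMass : EuclideanSpace ℝ (Fin n) → ℝ))) κ ∧
    KernelBound (dirD (EuclideanSpace.single i 1) (dirD (EuclideanSpace.single j 1)
      (radialBump : EuclideanSpace ℝ (Fin n) → ℝ))) κ := by
  have h1 (p : Fin n × Fin n) := ((isKernel_radialMass.isKernel_dirD
    (EuclideanSpace.single p.2 (1 : ℝ))).isKernel_dirD
      (EuclideanSpace.single p.1 (1 : ℝ))).exists_kernelBound
  have h2 (p : Fin n × Fin n) := ((isKernel_radialBump.isKernel_dirD
    (EuclideanSpace.single p.2 (1 : ℝ))).isKernel_dirD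
      (EuclideanSpace.single p.1 (1 : ℝ))).exists_kernelBound
  choose k hk using h1
  choose l hl using h2
  obtain ⟨κ, hκ⟩ := (Set.finite_range fun p => max (k p) (l p)).bddAbove
  have hp (i j : Fin n) : max (k (i, j)) (l (i, j)) ≤ κ := hκ ⟨(i, j), rfl⟩
  exact ⟨κ, fun i j => ⟨(hk (i, j)).mono ((le_max_left _ _).trans (hp i j)),
    (hl (i, j)).mono ((le_max_right _ _).trans (hp i j))⟩⟩

end PartialDerivatives

section RealBounds

variable {n : ℕ} {Ω : Set (EuclideanSpace ℝ (Fin n))} {α u f : EuclideanSpace ℝ (Fin n) → ℝ}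
  {S N : ℝ}

theorem PoissonBounds.contDiffAt (h : PoissonBounds Ω α u f S N) {x : EuclideanSpace ℝ (Fin n)}
    (hx : x ∈ Ω) : ContDiffAt ℝ 2 u x :=
  h.contDiffOn.contDiffAt (h.isOpen.mem_nhds hx)

theorem PoissonBounds.bdist_mul_abs_dirD_le (h : PoissonBounds Ω α u f S N)
    {e x : EuclideanSpace ℝ (Fin n)} {H : ℝ} (he : ‖e‖ = 1) (hx : x ∈ Ω) (hd : 0 < bdist Ω x)
    (hH : ∀ z ∈ Ω, ∀ d, 0 < d → d ≤ bdist Ω z → d ^ 2 * |dirD e (dirD e u) z| ≤ H) :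
    bdist Ω x * |dirD e u x| ≤ 4 * S + 2 * H := by
  set d := bdist Ω x with hdef
  have hdist (s : ℝ) : dist x (x + s • e) = |s| := by simp [dist_eq_norm, norm_smul, he]
  have hmem {s : ℝ} (hs : s ∈ Set.Icc 0 (d / 2)) : x + s • e ∈ Ω :=
    ball_bdist_subset h.isOpen hx (by
      rw [mem_ball, dist_comm, hdist, abs_of_nonneg hs.1]
      linarith [hs.2])
  have hline (s : ℝ) : HasDerivAt (fun s : ℝ => x + s • e) e s := by
    simpa using ((hasDerivAt_id s).smul_const e).const_add x
  have key := abs_deriv_le_of_abs_deriv2_le (p := fun s => u (x + s • e))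
    (p' := fun s => dirD e u (x + s • e)) (p'' := fun s => dirD e (dirD e u) (x + s • e))
    (S := S) (H := H / (d / 2) ^ 2) (half_pos hd)
    (fun s hs => ((h.contDiffAt (hmem hs)).differentiableAt
      (by norm_num)).hasFDerivAt.comp_hasDerivAt s (hline s))
    (fun s hs => by
      have hd1 : DifferentiableAt ℝ (dirD e u) (x + s • e) :=
        (((h.contDiffAt (hmem hs)).fderiv_right (m := 1) (by norm_num)).differentiableAt
          one_ne_zero).clm_apply (differentiableAt_const e)
      exact hd1.hasFDerivAt.comp_hasDerivAt s (hline s))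
    (fun s hs => h.abs_le _ (hmem hs))
    (fun s hs => by
      rw [le_div_iff₀ (by positivity), mul_comm]
      refine hH _ (hmem hs) _ (half_pos hd) ?_
      have := bdist_le_add_dist (Ω := Ω) (x := x) (y := x + s • e)
      rw [hdist, abs_of_nonneg hs.1] at this
      linarith [hs.2])
  simp only [zero_smul, add_zero] at key
  calc d * |dirD e u x| ≤ d * (2 * S / (d / 2) + H / (d / 2) ^ 2 * (d / 2)) := by gcongr
    _ = _ := by field_simp; ring

end RealBounds

end VarHolder


open VarHolder in
theorem theorem3p3 (n : ℕ) (hn : 1 ≤ n) :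
    ∃ C : ℝ → ℝ → ℝ → ℝ → ℝ≥0,
      ∀ (Ω : Set (EuclideanSpace ℝ (Fin n))) (α u f : EuclideanSpace ℝ (Fin n) → ℝ),
        IsOpen Ω → Bornology.IsBounded Ω → VarHolder.IsLogExponent Ω α →
        ContDiffOn ℝ 2 u Ω → VarHolder.MemHolderClosure Ω α f →
        (∀ x ∈ Ω, (Δ u) x = f x) →
        VarHolder.starHolderNorm 2 Ω α u ≤
          (C (Metric.diam Ω) (VarHolder.expInf Ω α) (VarHolder.expSup Ω α)
              (VarHolder.cLog Ω α) : ℝ≥0∞) *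
            (VarHolder.supNorm Ω u + VarHolder.weightedHolderNorm 2 0 Ω α f) := by
  have : Nonempty (Fin n) := ⟨⟨0, hn⟩⟩
  obtain ⟨κ, hκ⟩ := exists_uniform_kernelBound n
  have hκ0 : 0 ≤ κ := (hκ ⟨0, hn⟩ ⟨0, hn⟩).1.nonneg
  set c := massConst (EuclideanSpace ℝ (Fin n))
  have hc : 0 < c := massConst_pos
  let C₂ : ℝ → ℝ := fun m => κ / c * (4 + 4 / m)
  let C₃ : ℝ → ℝ → ℝ → ℝ := fun m M Q =>
    8 * C₂ m + κ / c * (64 + (16 / (1 - M) + 8 / m + 8 * Q / m))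
  refine ⟨fun D m M L => (1 + (4 + 2 * C₂ m) + C₂ m + C₃ m M (max 1 D * Real.exp L)).toNNReal,
    fun Ω α u f ho hb hα hu hf hΔ => ?_⟩
  set m := expInf Ω α
  set M := expSup Ω α
  have hm : 0 < m := hα.expInf_pos
  have hM : M < 1 := hα.expSup_lt_one
  have hM1 : 0 < 1 - M := by linarith
  set Q := max 1 (diam Ω) * Real.exp (cLog Ω α)
  have hQ : 0 ≤ Q := by positivity
  have hC2 : 0 ≤ C₂ m := by positivity
  have hC3 : 0 ≤ C₃ m M Q := by positivity
  -- An infinite right-hand side is harmless because the constant is positive.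
  rcases eq_or_ne (supNorm Ω u + weightedHolderNorm 2 0 Ω α f) ∞ with htop | htop
  · rw [htop, ENNReal.mul_top]
    · exact le_top
    · rw [ENNReal.coe_ne_zero]
      exact (Real.toNNReal_pos.2 (by positivity)).ne'
  obtain ⟨hS, hN⟩ := ENNReal.add_ne_top.1 htop
  set S := (supNorm Ω u).toReal
  set N := (weightedHolderNorm 2 0 Ω α f).toReal
  have hS0 : 0 ≤ S := ENNReal.toReal_nonneg
  have hN0 : 0 ≤ N := ENNReal.toReal_nonneg
  have H : PoissonBounds Ω α u f S N :=
    { isOpen := ho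
      contDiffOn := hu
      laplacian_eq := hΔ
      nonneg := hN0
      abs_le := fun x hx => (ENNReal.ofReal_le_iff_le_toReal hS).1
        (le_iSup₂ (f := fun x (_ : x ∈ Ω) => ENNReal.ofReal |u x|) x hx)
      quotient_le := fun x hx y hy hxy => by
        refine (ENNReal.ofReal_le_iff_le_toReal hN).1 (le_trans ?_ le_add_self)
        refine le_trans ?_ (le_iSup₂_of_le x hx (le_iSup₂_of_le y hy
          (le_iSup₂_of_le hxy Fin.elim0 le_rfl)))
        simp [partialD_zero] }
  have hRHS : supNorm Ω u + weightedHolderNorm 2 0 Ω α f = ENNReal.ofReal (S + N) := by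
    rw [ENNReal.ofReal_add hS0 hN0, ENNReal.ofReal_toReal hS, ENNReal.ofReal_toReal hN]
  have hI {x : EuclideanSpace ℝ (Fin n)} (hx : x ∈ Ω) : α x ∈ Set.Icc m M := hα.mem_Icc hx
  have h2 (i j : Fin n) (x : EuclideanSpace ℝ (Fin n)) (hx : x ∈ Ω) (d : ℝ) (hd : 0 < d)
      (hdx : d ≤ bdist Ω x) :
      d ^ 2 * |dirD (EuclideanSpace.single i 1) (dirD (EuclideanSpace.single j 1) u) x| ≤
        C₂ m * (S + N) := by
    have h1 := H.abs_dirD_dirD_le (hκ i j).1 (hκ i j).2 hx hd hdx hm (hI hx).1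
    rw [abs_mul, abs_of_pos hc, ← mul_assoc, ← le_div_iff₀ hc] at h1
    refine h1.trans ?_
    calc κ * (4 * S + 4 / m * N) / c ≤ κ * (4 * S + 4 / m * N + (4 / m * S + 4 * N)) / c := by
          exact div_le_div_of_nonneg_right (mul_le_mul_of_nonneg_left
            (le_add_of_nonneg_right (by positivity)) hκ0) hc.le
      _ = C₂ m * (S + N) := by simp only [C₂]; ring
  have s0 : starSeminorm 0 Ω u ≤ ENNReal.ofReal (1 * (S + N)) := by
    refine iSup₂_le fun x hx => iSup_le fun σ => ENNReal.ofReal_le_ofReal ?_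
    rw [partialD_zero, pow_zero]
    linarith [H.abs_le x hx]
  have s1 : starSeminorm 1 Ω u ≤ ENNReal.ofReal ((4 + 2 * C₂ m) * (S + N)) := by
    refine iSup₂_le fun x hx => iSup_le fun σ => ENNReal.ofReal_le_ofReal ?_
    rw [partialD_one, pow_one]
    refine (H.bdist_mul_abs_dirD_le (by simp) hx (bdist_pos hn ho hb hx)
      (h2 (σ 0) (σ 0))).trans ?_
    linarith
  have s2 : starSeminorm 2 Ω u ≤ ENNReal.ofReal (C₂ m * (S + N)) := by
    refine iSup₂_le fun x hx => iSup_le fun σ => ENNReal.ofReal_le_ofReal ?_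
    rw [partialD_two (H.contDiffAt hx)]
    exact h2 _ _ x hx _ (bdist_pos hn ho hb hx) le_rfl
  have s3 : starHolderSeminorm 2 Ω α u ≤ ENNReal.ofReal (C₃ m M Q * (S + N)) := by
    refine iSup₂_le fun x hx => iSup₂_le fun y hy => iSup₂_le fun hxy σ =>
      ENNReal.ofReal_le_ofReal ?_
    rw [partialD_two (H.contDiffAt hx), partialD_two (H.contDiffAt hy)]
    set d := bdist₂ Ω x y
    have hd : 0 < d := lt_min (bdist_pos hn ho hb hx) (bdist_pos hn ho hb hy)
    have hdx : d ≤ bdist Ω x := min_le_left _ _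
    have hdy : d ≤ bdist Ω y := min_le_right _ _
    have hδ : 0 < dist x y := dist_pos.2 hxy
    have hx2 := h2 (σ 0) (σ 1) x hx d hd hdx
    have hy2 := h2 (σ 0) (σ 1) y hy d hd hdy
    push_cast
    rcases le_or_gt (dist x y) (d / 4) with hnear | hfar
    · have h1 := H.abs_dirD_dirD_sub_le (hκ (σ 0) (σ 1)).1 (hκ (σ 0) (σ 1)).2 hx hy hdx hdy rfl
        hδ hnear hm hM (hI hx) (hI hy) (hα.logHolderBound_cLog.rpow_le hα.mem_Ioc hx hy hδ
          (by linarith) (hdx.trans (bdist_le_diam hn hb hx)))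
      rw [← sub_mul, abs_mul, abs_of_pos hc, mul_div_right_comm, ← mul_assoc,
        ← le_div_iff₀ hc] at h1
      refine h1.trans ?_
      set q := 16 / (1 - M) + 8 / m + 8 * Q / m
      have hq : 0 ≤ q := by positivity
      calc κ * (64 * S + q * N) / c ≤ κ * (64 * S + q * N + (q * S + 64 * N)) / c := by
            exact div_le_div_of_nonneg_right (mul_le_mul_of_nonneg_left
              (le_add_of_nonneg_right (by positivity)) hκ0) hc.le
        _ = κ / c * (64 + q) * (S + N) := by ring
        _ ≤ C₃ m M Q * (S + N) := by
            gcongr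
            exact le_add_of_nonneg_left (by positivity)
    · set Dx := dirD (EuclideanSpace.single (σ 0) 1) (dirD (EuclideanSpace.single (σ 1) 1) u) x
      set Dy := dirD (EuclideanSpace.single (σ 0) 1) (dirD (EuclideanSpace.single (σ 1) 1) u) y
      have hα0 : 0 < α x := hm.trans_le (hI hx).1
      have hpow : d ^ α x / dist x y ^ α x ≤ 4 := by
        rw [← Real.div_rpow hd.le hδ.le]
        calc (d / dist x y) ^ α x ≤ 4 ^ α x := by
              gcongr
              rw [div_le_iff₀ hδ]
              linarith
          _ ≤ 4 := by
              simpa using Real.rpow_le_rpow_of_exponent_le (by norm_num : (1 : ℝ) ≤ 4)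
                (hα.mem_Ioc x hx).2
      calc d ^ (2 + α x) * (|Dx - Dy| / dist x y ^ α x)
          = d ^ α x / dist x y ^ α x * (d ^ 2 * |Dx - Dy|) := by
            rw [Real.rpow_add hd, Real.rpow_two]
            ring
        _ ≤ 4 * (d ^ 2 * (|Dx| + |Dy|)) := by
            gcongr
            exact abs_sub Dx Dy
        _ ≤ 8 * C₂ m * (S + N) := by linarith
        _ ≤ C₃ m M Q * (S + N) := by
            gcongr
            exact le_add_of_nonneg_right (by positivity)
  have hSN : 0 ≤ S + N := by positivity
  rw [starHolderNorm, hRHS, ENNReal.ofNNReal_toNNReal, ← ENNReal.ofReal_mul (by positivity)]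
  simp only [Finset.sum_range_succ, Finset.sum_range_zero, zero_add]
  rw [add_mul, add_mul, add_mul, ENNReal.ofReal_add (by positivity) (by positivity),
    ENNReal.ofReal_add (by positivity) (by positivity),
    ENNReal.ofReal_add (by positivity) (by positivity)]
  gcongr
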